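/- Let $\mathsf N\ge 0$, $2s_1,\dots,2s_{\mathsf N}\in\mathbb Z_{>0}$, $\eta,\xi_1,\dots,\xi_{\mathsf N}\in\mathbb C$ and $K\in\mathrm{End}(\mathbb C^2)$ be arbitrary. Put $\mathcal H=\bigotimes_{n=1}^{\mathsf N}\mathbb C^{2s_n+1}$ and let $S_n^z=\mathrm{diag}(s_n,s_n-1,\dots,-s_n)$, $S_n^+=(S_n^-)^t$, where $S_n^+$ has entries $\sqrt{j(2s_n+1-j)}$ at $(j,j+1)$, $1\le j\le 2s_n$, and zeros elsewhere, act on the $n$-th factor. Define $$\mathsf L_{0n}(\lambda)=\begin{pmatrix}\lambda+\eta(\tfrac12+S_n^z)&\eta S_n^-\\ \eta S_n^+&\lambda+\eta(\tfrac12-S_n^z)\end{pmatrix}_0,\qquad \mathsf M_0(\lambda)=K_0\,\mathsf L_{0\mathsf N}(\lambda-\xi_{\mathsf N})\cdots\mathsf L_{01}(\lambda-\xi_1),\qquad \mathsf T^{(K)}(\lambda)=\mathrm{tr}_0\,\mathsf M_0(\lambda)\in\mathrm{End}(\mathcal H),$$ where $0$ denotes an auxiliary space $\mathbb C^2$. For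 $l\ge 1$ let $P^+_{1\dots l}$ be the symmetric projector on $(\mathbb C^2)^{\otimes l}$, $V^+_{1\dots l}$ its range, and let the fused transfer matrix be $$\mathsf T^{(K|l)}(\lambda)=\mathrm{tr}_{V^+_{1\dots l}}\big[P^+_{1\dots l}\,\mathsf M_1(\lambda+(l-1)\eta)\cdots\mathsf M_{l-1}(\lambda+\eta)\,\mathsf M_l(\lambda)\,P^+_{1\dots l}\big]\in\mathrm{End}(\mathcal H).$$ Let $\mathsf k_1,\mathsf k_2$ be the eigenvalues of $K$, counted with algebraic multiplicity and in either order, and put $$a(\lambda)=\prod_{n=1}^{\mathsf N}\big(\lambda-\xi_n+\tfrac{\eta}{2}+s_n\eta\big),\qquad d(\lambda)=\prod_{n=1}^{\mathsf N}\big(\lambda-\xi_n+\tfrac{\eta}{2}-s_n\eta\big),\qquad \xi_n^{(k)}=\xi_n-\tfrac{\eta}{2}+(s_n-k)\eta .$$ Let $D_l(\mathsf T^{(K)}(\lambda))$ be the tridiagonal $l\times l$ matrix whose $i$-th row ($1\le i\le l$) has, with $\mu_i=\lambda+(l-i)\eta$, the entry $\mathsf T^{(K)}(\mu_i)$ on the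 diagonal, $-\mathsf k_1a(\mu_i)$ to the right of it (for $i<l$) and $-\mathsf k_2d(\mu_i)$ to the left of it (for $i>1$). Then: 1. $\mathsf T^{(K)}(\lambda)$ is a polynomial in $\lambda$ with coefficients in $\mathrm{End}(\mathcal H)$, of degree at most $\mathsf N$, whose coefficient of $\lambda^{\mathsf N}$ is $\mathrm{tr}(K)\,\mathrm{id}_{\mathcal H}$ (so its degree is exactly $\mathsf N$ when $\mathrm{tr}\,K\ne 0$), and $$\lim_{\lambda\to\infty}\lambda^{-\mathsf N}\,\mathsf T^{(K)}(\lambda)=\mathrm{tr}(K)\,\mathrm{id}_{\mathcal H}.$$ 2. The operators $\mathsf T^{(K)}(\lambda)$, $\lambda\in\mathbb C$, commute with each other (so that determinants of matrices with such entries are well defined), and $$\mathsf T^{(K|2s_n+1)}\big(\xi_n^{(2s_n)}\big)=\det D_{2s_n+1}\big(\mathsf T^{(K)}(\xi_n^{(2s_n)})\big)=0\qquad\text{for all } n\in\{1,\dots,\mathsf N\}.$$ -/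

import Mathlib

open scoped Topology

noncomputable section

namespace HigherSpin

/-- The operator `1 ⊗ ⋯ ⊗ A ⊗ ⋯ ⊗ 1` with `A` in the tensor factor `n`, written in the product
basis of a tensor product whose factor `k` has a basis indexed by `ι k`. The coefficient ring `R`
may itself be a ring of operators. -/
def embed {κ : Type} [Fintype κ] [DecidableEq κ] {ι : κ → Type} [∀ k, DecidableEq (ι k)]
    {R : Type} [Zero R] (n : κ) (A : Matrix (ι n) (ι n) R) :
    Matrix (∀ k, ι k) (∀ k, ι k) R :=
  Matrix.of fun h h' => if ∀ k, k ≠ n → h k = h' k then A (h n) (h' n) else 0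

/-! ### Spin representations; the natural number `p` is twice the spin. -/

/-- `S^z = diag(s, s - 1, …, -s)` with `s = p / 2`. -/
def spinZ (p : ℕ) : Matrix (Fin (p + 1)) (Fin (p + 1)) ℂ :=
  Matrix.diagonal fun i => (p : ℂ) / 2 - (i : ℕ)

/-- `S^+`: its entry in row `j` and column `j + 1` (counted from `1`) is `√(j (2s + 1 - j))`,
all other entries vanish. -/
def spinPlus (p : ℕ) : Matrix (Fin (p + 1)) (Fin (p + 1)) ℂ :=
  Matrix.of fun i j =>
    if (j : ℕ) = (i : ℕ) + 1 then
      ((Real.sqrt (((i : ℕ) + 1 : ℝ) * ((p : ℝ) + 1 - ((i : ℕ) + 1))) : ℝ) : ℂ)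
    else 0

/-- `S^-` is the transpose of `S^+`. -/
def spinMinus (p : ℕ) : Matrix (Fin (p + 1)) (Fin (p + 1)) ℂ :=
  (spinPlus p).transpose

section Chain

variable {N : ℕ} (m : Fin N → ℕ)

/-- `End(ℋ)`, where `ℋ` is the tensor product over the sites `n` of `ℂ^(m n + 1)`, as matrices in
the product basis. Here `m n` is twice the spin at site `n`. -/
abbrev Op : Type :=
  Matrix ((n : Fin N) → Fin (m n + 1)) ((n : Fin N) → Fin (m n + 1)) ℂ

/-- The Lax operator at site `n`, an element of `End(ℂ²) ⊗ End(ℋ)`, as a `2 × 2` matrix with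
entries in `End(ℋ)`. -/
def lax (η : ℂ) (n : Fin N) (u : ℂ) : Matrix (Fin 2) (Fin 2) (Op m) :=
  !![embed n ((u + η / 2) • (1 : Matrix (Fin (m n + 1)) (Fin (m n + 1)) ℂ) + η • spinZ (m n)),
      embed n (η • spinMinus (m n));
     embed n (η • spinPlus (m n)),
      embed n ((u + η / 2) • (1 : Matrix (Fin (m n + 1)) (Fin (m n + 1)) ℂ) - η • spinZ (m n))]

/-- A scalar matrix on an auxiliary space, extended to act as the identity on `ℋ`. -/
def auxOp {ι : Type} (A : Matrix ι ι ℂ) : Matrix ι ι (Op m) :=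
  A.map fun c => c • (1 : Op m)

/-- The monodromy matrix `K₀ L₀N(u - ξ_N) ⋯ L₀₁(u - ξ_1)`. -/
def monodromy (η : ℂ) (ξ : Fin N → ℂ) (K : Matrix (Fin 2) (Fin 2) ℂ) (u : ℂ) :
    Matrix (Fin 2) (Fin 2) (Op m) :=
  auxOp m K * (List.ofFn fun i : Fin N => lax m η i.rev (u - ξ i.rev)).prod

/-- The transfer matrix: the trace of the monodromy matrix over the auxiliary space. -/
def transfer (η : ℂ) (ξ : Fin N → ℂ) (K : Matrix (Fin 2) (Fin 2) ℂ) (u : ℂ) : Op m :=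
  (monodromy m η ξ K u).trace

/-- The operator `P_π (v₁ ⊗ ⋯ ⊗ v_l) = v_{π(1)} ⊗ ⋯ ⊗ v_{π(l)}` on the `l`-fold tensor power of
`ℂ²`, in the product basis. -/
def permOp {l : ℕ} (π : Equiv.Perm (Fin l)) : Matrix (Fin l → Fin 2) (Fin l → Fin 2) ℂ :=
  Matrix.of fun j i => if j = i ∘ π then 1 else 0

/-- The symmetric projector on the `l`-fold tensor power of `ℂ²`. -/
def symProj (l : ℕ) : Matrix (Fin l → Fin 2) (Fin l → Fin 2) ℂ :=
  (l.factorial : ℂ)⁻¹ • ∑ π : Equiv.Perm (Fin l), permOp π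

/-- The space of symmetric tensors, the range of the symmetric projector. -/
def symSpace (l : ℕ) : Submodule ℂ ((Fin l → Fin 2) → ℂ) :=
  LinearMap.range (Matrix.toLin' (symProj l))

/-- The fused monodromy matrix `P⁺ M₁(u + (l-1)η) ⋯ M_{l-1}(u + η) M_l(u) P⁺`. -/
def fusedMonodromy (η : ℂ) (ξ : Fin N → ℂ) (K : Matrix (Fin 2) (Fin 2) ℂ) (l : ℕ) (u : ℂ) :
    Matrix (Fin l → Fin 2) (Fin l → Fin 2) (Op m) :=
  auxOp m (symProj l) *
    ((List.ofFn fun j : Fin l =>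
        embed (ι := fun _ : Fin l => Fin 2) j
          (monodromy m η ξ K (u + ((l : ℂ) - 1 - (j : ℕ)) * η))).prod *
      auxOp m (symProj l))

/-- For fixed `h h'`, the matrix coefficient between the basis vectors `h'` and `h` of `ℋ`: an
operator on the auxiliary space. -/
def coeffAt {ι : Type} (X : Matrix ι ι (Op m))
    (h h' : (n : Fin N) → Fin (m n + 1)) : Matrix ι ι ℂ :=
  X.map fun A => A h h'

theorem coeffAt_auxOp_mul {ι : Type} [Fintype ι] (A : Matrix ι ι ℂ) (Y : Matrix ι ι (Op m))
    (h h' : (n : Fin N) → Fin (m n + 1)) :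
    coeffAt m (auxOp m A * Y) h h' = A * coeffAt m Y h h' := by
  ext i j
  simp [coeffAt, auxOp, Matrix.mul_apply, Matrix.sum_apply]

theorem fusedMonodromy_mapsTo (η : ℂ) (ξ : Fin N → ℂ) (K : Matrix (Fin 2) (Fin 2) ℂ)
    (l : ℕ) (u : ℂ) (h h' : (n : Fin N) → Fin (m n + 1)) :
    ∀ v ∈ symSpace l,
      Matrix.toLin' (coeffAt m (fusedMonodromy m η ξ K l u) h h') v ∈ symSpace l := by
  intro v _
  rw [fusedMonodromy, coeffAt_auxOp_mul, Matrix.toLin'_mul]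
  exact ⟨_, rfl⟩

/-- The fused transfer matrix: the partial trace over the space of symmetric tensors of the fused
monodromy matrix, an operator on `ℋ`. -/
def fusedTransfer (η : ℂ) (ξ : Fin N → ℂ) (K : Matrix (Fin 2) (Fin 2) ℂ) (l : ℕ) (u : ℂ) :
    Op m :=
  Matrix.of fun h h' =>
    LinearMap.trace ℂ (symSpace l)
      ((Matrix.toLin' (coeffAt m (fusedMonodromy m η ξ K l u) h h')).restrict
        (fusedMonodromy_mapsTo m η ξ K l u h h'))

/-- `a(u) = ∏ₙ (u - ξₙ + η/2 + sₙ η)` with `sₙ = m n / 2`. -/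
def aFun (η : ℂ) (ξ : Fin N → ℂ) (u : ℂ) : ℂ :=
  ∏ n, (u - (ξ n - η / 2) + (m n : ℂ) / 2 * η)

/-- `d(u) = ∏ₙ (u - ξₙ + η/2 - sₙ η)` with `sₙ = m n / 2`. -/
def dFun (η : ℂ) (ξ : Fin N → ℂ) (u : ℂ) : ℂ :=
  ∏ n, (u - (ξ n - η / 2) - (m n : ℂ) / 2 * η)

/-- The shifted inhomogeneity `ξₙ^(k) = ξₙ - η/2 + (sₙ - k) η` with `sₙ = m n / 2`. -/
def shiftedXi (η : ℂ) (ξ : Fin N → ℂ) (n : Fin N) (k : ℕ) : ℂ :=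
  ξ n - η / 2 + ((m n : ℂ) / 2 - (k : ℂ)) * η

/-- The tridiagonal `l × l` matrix with operator entries whose row `i` (counted from `0`), with
`v = u + (l - 1 - i) η`, has `-k₂ d(v)` left of the diagonal, the transfer matrix at `v` on the
diagonal and `-k₁ a(v)` right of the diagonal. -/
def tridiag (η : ℂ) (ξ : Fin N → ℂ) (K : Matrix (Fin 2) (Fin 2) ℂ) (k₁ k₂ : ℂ) (l : ℕ) (u : ℂ) :
    Matrix (Fin l) (Fin l) (Op m) :=
  Matrix.of fun i j =>
    if j = i then transfer m η ξ K (u + ((l : ℂ) - 1 - (i : ℕ)) * η)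
    else if (j : ℕ) = (i : ℕ) + 1 then
      (-(k₁ * aFun m η ξ (u + ((l : ℂ) - 1 - (i : ℕ)) * η))) • (1 : Op m)
    else if (i : ℕ) = (j : ℕ) + 1 then
      (-(k₂ * dFun m η ξ (u + ((l : ℂ) - 1 - (i : ℕ)) * η))) • (1 : Op m)
    else 0

end Chain

/-- The determinant by the Leibniz formula of a matrix over a ring which need not be commutative,
the factors of each product being ordered by columns. It is the usual determinant when the entries
commute with each other (then the order is irrelevant), the only case in which it is used. -/
def opDet {R : Type} [Ring R] {l : ℕ} (A : Matrix (Fin l) (Fin l) R) : R :=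
  ∑ σ : Equiv.Perm (Fin l),
    ((Equiv.Perm.sign σ : ℤˣ) : ℤ) • (List.ofFn fun j : Fin l => A (σ j) j).prod

end HigherSpin

end

namespace HigherSpin

/-! Symmetric tensors are encoded by polynomials: a basis vector of the `l`-fold tensor power of
`ℂ²` with `k` ones becomes `X^k`. A column of a `2 × 2` operator matrix becomes a linear polynomial
(`rowPoly`), and an ordered product of columns (`rowProd`) describes `P⁺ A₁ ⋯ A_l` on a basis
vector.

The spin relations yield a Manin relation between `M(λ + η)` and `M(λ)`: antisymmetrising the
columns antisymmetrises the rows and leaves the quantum determinant `k₁ k₂ a(λ + η) d(λ)`. In the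
polynomial picture this says that neighbouring columns may be exchanged
(`IsManin.rowPoly_mul_comm`). A product therefore depends only on its number of ones, and the trace
over symmetric tensors is a sum of single coefficients (`symTrace`, `fusedTransfer_eq_symTrace`).
Splitting off the last factor gives the fusion relation `symTrace_succ_succ`, which is also the
recursion of the tridiagonal determinant.

At the special point even `P⁺ M ⋯ M` vanishes, before any trace is taken. Products over sites factor
through symmetric tensors (`rowProd_mul`), so the single site `n` suffices. There the constant terms
are words in `S⁻` and in diagonal matrices that annihilate one basis vector after another
(`prod_laxMatrix_apply_eq_zero`); covariance under `S⁺` carries the vanishing to the higher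
coefficients (`rowProd_eq_zero_of_coeff_zero`).

Commutativity follows from the RTT relation, and polynomiality from the fact that each Lax matrix is
`λ` plus a constant. -/

open Polynomial


/-! ### Column polynomials and the fusion relation -/

section RowPolynomials

variable {R : Type*} [Ring R]

/-- The generating polynomial `A₀c + A₁c X` of the column `c` of a `2 × 2` matrix. -/
noncomputable def rowPoly (A : Matrix (Fin 2) (Fin 2) R) (c : Fin 2) : R[X] :=
  C (A 0 c) + C (A 1 c) * X

/-- The ordered product of the column polynomials of `A 0, …, A (l - 1)`. -/
noncomputable def rowProd (A : ℕ → Matrix (Fin 2) (Fin 2) R) (l : ℕ) (I : Fin l → Fin 2) : R[X] :=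
  (List.ofFn fun j : Fin l => rowPoly (A j) (I j)).prod

/-- The matrix entries of the ordered product of `A 0, …, A (l - 1)`, the `j`-th factor acting on
the `j`-th tensor factor. -/
def word (A : ℕ → Matrix (Fin 2) (Fin 2) R) (l : ℕ) (J I : Fin l → Fin 2) : R :=
  (List.ofFn fun j : Fin l => A j (J j) (I j)).prod

/-- The number of ones in a multi-index. -/
def weight {l : ℕ} (I : Fin l → Fin 2) : ℕ := ∑ j, (I j : ℕ)

/-- The multi-index `1ᵏ 0ˡ⁻ᵏ`. -/
def stdIndex (l k : ℕ) : Fin l → Fin 2 := fun j => if (j : ℕ) < k then 1 else 0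

/-- The Manin relations between two matrices, with quantum determinant `q`. -/
def IsManin (A B : Matrix (Fin 2) (Fin 2) R) (q : R) : Prop :=
  ∀ a b, A a 0 * B b 1 - A a 1 * B b 0 = (!![0, 1; -1, 0] : Matrix (Fin 2) (Fin 2) R) a b * q

/-- All entries of one matrix commute with all entries of the other. -/
def EntriesCommute (A B : Matrix (Fin 2) (Fin 2) R) : Prop :=
  ∀ a b c d, Commute (A a b) (B c d)

theorem EntriesCommute.mul_right {A B B' : Matrix (Fin 2) (Fin 2) R} (h : EntriesCommute A B)
    (h' : EntriesCommute A B') : EntriesCommute A (B * B') := by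
  intro a b c d
  rw [Matrix.mul_apply]
  exact Commute.sum_right _ _ _ fun e _ => (h _ _ _ _).mul_right (h' _ _ _ _)

theorem EntriesCommute.one_right (A : Matrix (Fin 2) (Fin 2) R) : EntriesCommute A 1 := by
  intro a b c d
  rw [Matrix.one_apply]
  split_ifs
  · exact Commute.one_right _
  · exact Commute.zero_right _

theorem EntriesCommute.list_prod_right {A : Matrix (Fin 2) (Fin 2) R} :
    ∀ s : List (Matrix (Fin 2) (Fin 2) R), (∀ B ∈ s, EntriesCommute A B) →
      EntriesCommute A s.prod
  | [], _ => by simpa using EntriesCommute.one_right A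
  | B :: s, h => by
    rw [List.prod_cons]
    exact (h B (by simp)).mul_right (list_prod_right s fun B' hB' => h B' (by simp [hB']))

/-- Once `A'` has passed `B`, the relation for `B, B'` antisymmetrises the intermediate indices,
which are the column indices of `A, A'`. Quantum determinants are thus multiplicative. -/
theorem IsManin.mul {A A' B B' : Matrix (Fin 2) (Fin 2) R} {q r : R} (hA : IsManin A A' q)
    (hB : IsManin B B' r) (hc : EntriesCommute A' B) : IsManin (A * B) (A' * B') (q * r) := by
  intro a b
  have key : ∀ c d, (A * B) a c * (A' * B') b d =
      ∑ e, ∑ f, A a e * A' b f * (B e c * B' f d) := by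
    intro c d
    simp only [Matrix.mul_apply, Finset.sum_mul_sum]
    refine Finset.sum_congr rfl fun e _ => Finset.sum_congr rfl fun f _ => ?_
    rw [mul_assoc, mul_assoc, ← mul_assoc (B e c), ← (hc b f e c).eq, mul_assoc]
  have step : (A * B) a 0 * (A' * B') b 1 - (A * B) a 1 * (A' * B') b 0 =
      ∑ e, ∑ f, A a e * A' b f * (B e 0 * B' f 1 - B e 1 * B' f 0) := by
    rw [key, key, ← Finset.sum_sub_distrib]
    refine Finset.sum_congr rfl fun e _ => ?_
    rw [← Finset.sum_sub_distrib]
    exact Finset.sum_congr rfl fun f _ => (mul_sub _ _ _).symm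
  rw [step, ← mul_assoc, ← hA a b]
  simp only [hB _ _, Fin.sum_univ_two]
  simp [sub_mul]
  abel

/-- A coefficient in `X` sees the row indices only up to symmetry, so the quantum determinant,
antisymmetric in them, cancels. -/
theorem IsManin.rowPoly_mul_comm {A B : Matrix (Fin 2) (Fin 2) R} {q : R} (h : IsManin A B q)
    (c d : Fin 2) : rowPoly A c * rowPoly B d = rowPoly A d * rowPoly B c := by
  have key : rowPoly A 0 * rowPoly B 1 = rowPoly A 1 * rowPoly B 0 := by
    have h00 := h 0 0
    have h01 := h 0 1
    have h10 := h 1 0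
    have h11 := h 1 1
    simp at h00 h01 h10 h11
    have e : ∀ a b c d : R, (C a + C b * X) * (C c + C d * X) =
        C (a * c) + C (a * d + b * c) * X + C (b * d) * X ^ 2 := by
      intro a b c d
      simp only [mul_add, add_mul, C_add, C_mul, mul_assoc, X_mul_C, pow_two]
      rw [← mul_assoc X (C d), X_mul_C, mul_assoc]
      abel
    simp only [rowPoly, e]
    have m : A 0 0 * B 1 1 + A 1 0 * B 0 1 = A 0 1 * B 1 0 + A 1 1 * B 0 0 := by
      rw [← sub_eq_zero]
      calc _ = (A 0 0 * B 1 1 - A 0 1 * B 1 0) + (A 1 0 * B 0 1 - A 1 1 * B 0 0) := by abel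
        _ = 0 := by rw [h01, h10]; abel
    rw [sub_eq_zero.1 h00, sub_eq_zero.1 h11, m]
  fin_cases c <;> fin_cases d <;> first | rfl | exact key | exact key.symm

theorem rowProd_zero (A : ℕ → Matrix (Fin 2) (Fin 2) R) (I : Fin 0 → Fin 2) :
    rowProd A 0 I = 1 := by
  simp [rowProd]

theorem rowProd_succ (A : ℕ → Matrix (Fin 2) (Fin 2) R) (l : ℕ) (I : Fin (l + 1) → Fin 2) :
    rowProd A (l + 1) I =
      rowProd A l (fun j => I j.castSucc) * rowPoly (A l) (I (Fin.last l)) := by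
  rw [rowProd, List.ofFn_succ_last, List.prod_append, List.prod_singleton]
  rfl

theorem rowProd_stdIndex_succ_zero (A : ℕ → Matrix (Fin 2) (Fin 2) R) {l k : ℕ} (hk : k ≤ l) :
    rowProd A (l + 1) (stdIndex (l + 1) k) =
      rowProd A l (stdIndex l k) * rowPoly (A l) 0 := by
  rw [rowProd_succ]
  congr 2
  simp [stdIndex, hk]

/-- The ones of `stdIndex` stand on the left, so a one appended on the right has to travel through
the zeros by exchanges of neighbouring columns. -/
theorem rowProd_stdIndex_succ_one {A : ℕ → Matrix (Fin 2) (Fin 2) R} {q : ℕ → R}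
    (h : ∀ j, IsManin (A j) (A (j + 1)) (q j)) : ∀ {l k : ℕ}, k ≤ l →
    rowProd A (l + 1) (stdIndex (l + 1) (k + 1)) =
      rowProd A l (stdIndex l k) * rowPoly (A l) 1 := by
  intro l
  induction l with
  | zero =>
    intro k hk
    obtain rfl : k = 0 := by omega
    rw [rowProd_succ]
    simp [stdIndex, rowProd_zero]
  | succ l ih =>
    intro k hk
    rcases hk.lt_or_eq with hk' | rfl
    · rw [rowProd_stdIndex_succ_zero A (by omega), ih (by omega), mul_assoc,
        (h l).rowPoly_mul_comm, ← mul_assoc, ← rowProd_stdIndex_succ_zero A (by omega)]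
    · rw [rowProd_succ]
      congr 2
      · funext j
        have := j.2
        simp [stdIndex]
        omega
      · simp [stdIndex]

/-- The trace over symmetric tensors of the ordered product of `A 0, …, A (l - 1)`. -/
noncomputable def symTrace (A : ℕ → Matrix (Fin 2) (Fin 2) R) (l : ℕ) : R :=
  ∑ k ∈ Finset.range (l + 1), (rowProd A l (stdIndex l k)).coeff k

theorem symTrace_zero (A : ℕ → Matrix (Fin 2) (Fin 2) R) : symTrace A 0 = 1 := by
  simp [symTrace, rowProd_zero]

theorem coeff_mul_rowPoly_zero (f : R[X]) (A : Matrix (Fin 2) (Fin 2) R) (c : Fin 2) :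
    (f * rowPoly A c).coeff 0 = f.coeff 0 * A 0 c := by
  simp [rowPoly, mul_add, ← mul_assoc]

theorem coeff_mul_rowPoly_succ (f : R[X]) (A : Matrix (Fin 2) (Fin 2) R) (c : Fin 2) (k : ℕ) :
    (f * rowPoly A c).coeff (k + 1) = f.coeff (k + 1) * A 0 c + f.coeff k * A 1 c := by
  simp [rowPoly, mul_add, ← mul_assoc]

theorem coeff_rowProd_of_lt (A : ℕ → Matrix (Fin 2) (Fin 2) R) :
    ∀ {l : ℕ} (I : Fin l → Fin 2) {k : ℕ}, l < k → (rowProd A l I).coeff k = 0 := by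
  intro l
  induction l with
  | zero =>
    intro I k hk
    rw [rowProd_zero, coeff_one, if_neg (by omega)]
  | succ l ih =>
    intro I k hk
    obtain ⟨k, rfl⟩ : ∃ k', k = k' + 1 := ⟨k - 1, by omega⟩
    rw [rowProd_succ, coeff_mul_rowPoly_succ, ih _ (by omega), ih _ (by omega)]
    simp

/-- The `A l 0 0` terms are complete, but of the `A l 1 1` terms only the one with `k = l` occurs.
The correction subtracts the missing ones and keeps the off-diagonal `A l 1 0` terms. -/
theorem symTrace_succ_aux {A : ℕ → Matrix (Fin 2) (Fin 2) R} {q : ℕ → R}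
    (h : ∀ j, IsManin (A j) (A (j + 1)) (q j)) (l : ℕ) :
    symTrace A (l + 1) = symTrace A l * (A l).trace +
      ∑ k ∈ Finset.range l, ((rowProd A l (stdIndex l (k + 1))).coeff k * A l 1 0 -
        (rowProd A l (stdIndex l k)).coeff k * A l 1 1) := by
  have e : ∀ k ∈ Finset.range l, (rowProd A (l + 1) (stdIndex (l + 1) (k + 1))).coeff (k + 1) =
      (rowProd A l (stdIndex l (k + 1))).coeff (k + 1) * A l 0 0 +
      (rowProd A l (stdIndex l (k + 1))).coeff k * A l 1 0 := by
    intro k hk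
    rw [rowProd_stdIndex_succ_zero A (by simp at hk; omega), coeff_mul_rowPoly_succ]
  rw [symTrace, Finset.sum_range_succ, Finset.sum_range_succ', Finset.sum_congr rfl e,
    rowProd_stdIndex_succ_one h le_rfl, rowProd_stdIndex_succ_zero A (Nat.zero_le _),
    coeff_mul_rowPoly_succ, coeff_mul_rowPoly_zero, coeff_rowProd_of_lt A _ (Nat.lt_succ_self l),
    Matrix.trace_fin_two, mul_add]
  have e0 : symTrace A l * A l 0 0 =
      ∑ k ∈ Finset.range l, (rowProd A l (stdIndex l (k + 1))).coeff (k + 1) * A l 0 0 +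
        (rowProd A l (stdIndex l 0)).coeff 0 * A l 0 0 := by
    rw [symTrace, Finset.sum_range_succ', add_mul, Finset.sum_mul]
  have e1 : symTrace A l * A l 1 1 =
      ∑ k ∈ Finset.range l, (rowProd A l (stdIndex l k)).coeff k * A l 1 1 +
        (rowProd A l (stdIndex l l)).coeff l * A l 1 1 := by
    rw [symTrace, Finset.sum_range_succ, add_mul, Finset.sum_mul]
  rw [e0, e1, Finset.sum_add_distrib, Finset.sum_sub_distrib]
  simp only [zero_mul, zero_add]
  abel

theorem symTrace_one {A : ℕ → Matrix (Fin 2) (Fin 2) R} {q : ℕ → R}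
    (h : ∀ j, IsManin (A j) (A (j + 1)) (q j)) : symTrace A 1 = (A 0).trace := by
  rw [symTrace_succ_aux h, symTrace_zero]
  simp

/-- The fusion relation. -/
theorem symTrace_succ_succ {A : ℕ → Matrix (Fin 2) (Fin 2) R} {q : ℕ → R}
    (h : ∀ j, IsManin (A j) (A (j + 1)) (q j)) (l : ℕ) :
    symTrace A (l + 2) = symTrace A (l + 1) * (A (l + 1)).trace - symTrace A l * q l := by
  rw [symTrace_succ_aux h, sub_eq_add_neg]
  congr 1
  rw [symTrace, Finset.sum_mul, ← Finset.sum_neg_distrib]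
  refine Finset.sum_congr rfl fun k hk => ?_
  rw [rowProd_stdIndex_succ_one h (by simp at hk; omega),
    rowProd_stdIndex_succ_zero A (by simp at hk; omega)]
  have h01 := h l 0 1
  have h11 := h l 1 1
  simp at h01 h11
  -- The correction is `-f_k` times the `(0, 1)` Manin relation, giving `-f_k q`, plus a multiple of
  -- `f_(k-1)` which vanishes by the `(1, 1)` relation.
  set f := rowProd A l (stdIndex l k)
  rw [← h01]
  cases k with
  | zero =>
    rw [coeff_mul_rowPoly_zero, coeff_mul_rowPoly_zero]
    noncomm_ring
  | succ k =>
    rw [coeff_mul_rowPoly_succ, coeff_mul_rowPoly_succ]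
    have : f.coeff k * (A l 1 0 * A (l + 1) 1 1 - A l 1 1 * A (l + 1) 1 0) = 0 := by
      rw [h11, mul_zero]
    rw [← sub_eq_zero, ← neg_eq_zero.2 this]
    generalize A (l + 1) = B
    noncomm_ring

end RowPolynomials


/-! ### Invariance under permutations of the columns -/

section Symmetry

theorem prod_ofFn_swap {S : Type*} [Monoid S] : ∀ {l : ℕ} (f : Fin (l + 1) → Fin 2 → S),
    (∀ (i : Fin l) (c d : Fin 2), f i.castSucc c * f i.succ d = f i.castSucc d * f i.succ c) →
    ∀ (I : Fin (l + 1) → Fin 2) (i : Fin l),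
      (List.ofFn fun j => f j (I (Equiv.swap i.castSucc i.succ j))).prod =
        (List.ofFn fun j => f j (I j)).prod := by
  intro l
  induction l with
  | zero => intro f _ I i; exact i.elim0
  | succ l ih =>
    intro f hf I i
    refine Fin.cases ?_ (fun i => ?_) i
    · have e : ∀ j : Fin l, Equiv.swap (0 : Fin (l + 2)) (Fin.succ 0) j.succ.succ = j.succ.succ :=
        fun j => Equiv.swap_apply_of_ne_of_ne (Fin.succ_ne_zero _)
          (fun h => Fin.succ_ne_zero _ (Fin.succ_injective _ h))
      rw [List.ofFn_succ, List.ofFn_succ, List.ofFn_succ (f := fun j => f j (I j)),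
        List.ofFn_succ (f := fun j : Fin (l + 1) => f j.succ (I j.succ))]
      simp only [List.prod_cons, Fin.castSucc_zero, Equiv.swap_apply_left, Equiv.swap_apply_right,
        e, ← mul_assoc]
      have := hf 0 (I (Fin.succ 0)) (I 0)
      rw [Fin.castSucc_zero] at this
      rw [this]
    · have e0 : Equiv.swap i.succ.castSucc i.succ.succ (0 : Fin (l + 2)) = 0 :=
        Equiv.swap_apply_of_ne_of_ne (by simp [Fin.ext_iff]) (by simp [Fin.ext_iff])
      have e : ∀ j : Fin (l + 1), Equiv.swap i.succ.castSucc i.succ.succ j.succ =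
          (Equiv.swap i.castSucc i.succ j).succ := by
        intro j
        rw [← Fin.succ_castSucc]
        simp only [Equiv.swap_apply_def, Fin.succ_inj]
        split_ifs <;> rfl
      rw [List.ofFn_succ, List.ofFn_succ (f := fun j => f j (I j))]
      simp only [List.prod_cons, e0, e]
      rw [ih (fun j => f j.succ) (fun i c d => by simpa using hf i.succ c d) (fun j => I j.succ) i]

variable {R : Type*} [Ring R]

theorem rowProd_comp_perm {A : ℕ → Matrix (Fin 2) (Fin 2) R} {q : ℕ → R}
    (h : ∀ j, IsManin (A j) (A (j + 1)) (q j)) {l : ℕ} (π : Equiv.Perm (Fin l)) :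
    ∀ I : Fin l → Fin 2, rowProd A l (I ∘ π) = rowProd A l I := by
  cases l with
  | zero => intro I; rw [rowProd_zero, rowProd_zero]
  | succ l =>
    -- Adjacent transpositions generate the symmetric group already as a monoid, so inverses need no
    -- treatment.
    have hπ : π ∈ Submonoid.closure
        (Set.range fun i : Fin l => Equiv.swap i.castSucc i.succ) := by
      rw [Equiv.Perm.mclosure_swap_castSucc_succ]
      trivial
    induction hπ using Submonoid.closure_induction with
    | mem π hπ =>
      obtain ⟨i, rfl⟩ := hπ
      intro I
      exact prod_ofFn_swap (fun j => rowPoly (A j))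
        (fun i c d => (h i).rowPoly_mul_comm c d) I i
    | one => intro I; rfl
    | mul π σ _ _ hπ hσ =>
      intro I
      rw [Equiv.Perm.coe_mul, ← Function.comp_assoc, hσ, hπ]

end Symmetry

/-! ### Weights, words and the symmetrised trace -/

section Weights

theorem weight_eq_card {l : ℕ} (I : Fin l → Fin 2) :
    weight I = Fintype.card {j // I j = 1} := by
  rw [weight, Fintype.card_subtype, Finset.card_filter]
  refine Finset.sum_congr rfl fun j _ => ?_
  generalize I j = c
  fin_cases c <;> rfl

theorem weight_comp_perm {l : ℕ} (I : Fin l → Fin 2) (π : Equiv.Perm (Fin l)) :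
    weight (I ∘ π) = weight I :=
  Equiv.sum_comp π fun j => (I j : ℕ)

theorem weight_le {l : ℕ} (I : Fin l → Fin 2) : weight I ≤ l := by
  rw [weight_eq_card]
  exact (Fintype.card_subtype_le _).trans (Fintype.card_fin l).le

theorem weight_stdIndex {l k : ℕ} (hk : k ≤ l) : weight (stdIndex l k) = k := by
  have : ∀ j : Fin l, ((stdIndex l k j : Fin 2) : ℕ) = if (j : ℕ) < k then 1 else 0 := by
    intro j
    rw [stdIndex]
    split_ifs <;> rfl
  rw [weight, Finset.sum_congr rfl fun j _ => this j,
    Fin.sum_univ_eq_sum_range (fun j => if j < k then 1 else 0) l, ← Finset.card_filter]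
  have : (Finset.range l).filter (· < k) = Finset.range k := by
    ext j
    simp
    omega
  rw [this, Finset.card_range]

/-- Equal weights make the fibres over `0` and over `1` equinumerous, and bijections of the fibres
glue to a permutation. -/
theorem exists_comp_perm_eq {l : ℕ} {I J : Fin l → Fin 2} (h : weight I = weight J) :
    ∃ π : Equiv.Perm (Fin l), J ∘ π = I := by
  have h1 : Fintype.card {j // I j = 1} = Fintype.card {j // J j = 1} := by
    rw [← weight_eq_card, ← weight_eq_card, h]
  have h0 : Fintype.card {j // I j = 0} = Fintype.card {j // J j = 0} := by
    have e : ∀ L : Fin l → Fin 2, Fintype.card {j // L j = 0} =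
        Fintype.card (Fin l) - Fintype.card {j // L j = 1} := by
      intro L
      rw [← Fintype.card_subtype_compl]
      refine Fintype.card_congr (Equiv.subtypeEquivRight fun j => ?_)
      generalize L j = c
      fin_cases c <;> simp
    rw [e, e, h1]
  have hc : ∀ c : Fin 2, Nonempty ({j // I j = c} ≃ {j // J j = c}) := by
    intro c
    fin_cases c
    · exact ⟨Fintype.equivOfCardEq h0⟩
    · exact ⟨Fintype.equivOfCardEq h1⟩
  refine ⟨Equiv.ofFiberEquiv fun c => (hc c).some, ?_⟩
  funext j
  exact Equiv.ofFiberEquiv_map (fun c => (hc c).some) j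

variable {R : Type*} [Ring R]

theorem rowProd_eq_stdIndex {A : ℕ → Matrix (Fin 2) (Fin 2) R} {q : ℕ → R}
    (h : ∀ j, IsManin (A j) (A (j + 1)) (q j)) {l : ℕ} (I : Fin l → Fin 2) :
    rowProd A l I = rowProd A l (stdIndex l (weight I)) := by
  obtain ⟨π, hπ⟩ := exists_comp_perm_eq (I := I) (J := stdIndex l (weight I))
    (weight_stdIndex (weight_le I)).symm
  have := rowProd_comp_perm h π (stdIndex l (weight I))
  rwa [hπ] at this

theorem prod_ofFn_sum {l : ℕ} (f : Fin l → Fin 2 → R) :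
    (List.ofFn fun j => ∑ e, f j e).prod =
      ∑ E : Fin l → Fin 2, (List.ofFn fun j => f j (E j)).prod := by
  have := (MultilinearMap.mkPiAlgebraFin ℤ l R).map_sum (fun j e => f j e)
  simpa only [MultilinearMap.mkPiAlgebraFin_apply] using this

theorem prod_ofFn_mul : ∀ {l : ℕ} (f g : Fin l → R), (∀ i j, Commute (f i) (g j)) →
    (List.ofFn fun j => f j * g j).prod = (List.ofFn f).prod * (List.ofFn g).prod := by
  intro l
  induction l with
  | zero => intro f g _; simp
  | succ l ih =>
    intro f g h
    have hc : Commute (f (Fin.last l)) (List.ofFn fun j : Fin l => g j.castSucc).prod := by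
      refine Commute.list_prod_right _ _ fun x hx => ?_
      obtain ⟨j, rfl⟩ := List.mem_ofFn.1 hx
      exact h _ _
    simp only [List.ofFn_succ_last, List.prod_append, List.prod_singleton]
    rw [ih _ _ fun i j => h _ _, mul_assoc, ← mul_assoc _ (f _), ← hc.eq]
    simp only [mul_assoc]

theorem prod_ofFn_C : ∀ {l : ℕ} (f : Fin l → R),
    (List.ofFn fun j => C (f j)).prod = C (List.ofFn f).prod := by
  intro l f
  rw [map_list_prod, List.map_ofFn]
  rfl

theorem prod_ofFn_X_pow : ∀ {l : ℕ} (f : Fin l → ℕ),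
    (List.ofFn fun j => (X : R[X]) ^ f j).prod = X ^ ∑ j, f j := by
  intro l
  induction l with
  | zero => intro f; simp
  | succ l ih =>
    intro f
    rw [List.ofFn_succ_last, List.prod_append, ih, List.prod_singleton, Fin.sum_univ_castSucc,
      pow_add]

theorem rowPoly_eq_sum (A : Matrix (Fin 2) (Fin 2) R) (c : Fin 2) :
    rowPoly A c = ∑ e : Fin 2, C (A e c) * X ^ (e : ℕ) := by
  simp [rowPoly, Fin.sum_univ_two]

theorem rowProd_eq_sum (A : ℕ → Matrix (Fin 2) (Fin 2) R) {l : ℕ} (I : Fin l → Fin 2) :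
    rowProd A l I = ∑ J, C (word A l J I) * X ^ weight J := by
  simp only [rowProd, rowPoly_eq_sum, prod_ofFn_sum]
  refine Finset.sum_congr rfl fun J _ => ?_
  rw [prod_ofFn_mul (fun j : Fin l => C (A j (J j) (I j))) (fun j => X ^ (J j : ℕ))
    fun i j => (X_pow_mul_C _ _).symm, prod_ofFn_C, prod_ofFn_X_pow]
  rfl

theorem coeff_rowProd (A : ℕ → Matrix (Fin 2) (Fin 2) R) {l : ℕ} (I : Fin l → Fin 2) (k : ℕ) :
    (rowProd A l I).coeff k = ∑ J with weight J = k, word A l J I := by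
  rw [rowProd_eq_sum, finsetSum_coeff, Finset.sum_filter]
  refine Finset.sum_congr rfl fun J _ => ?_
  simp [coeff_X_pow, eq_comm]

theorem rowPoly_mul (A B : Matrix (Fin 2) (Fin 2) R) (c : Fin 2) :
    rowPoly (A * B) c = ∑ e, rowPoly A e * C (B e c) := by
  simp only [rowPoly, Matrix.mul_apply, Fin.sum_univ_two, add_mul, C_add, C_mul, mul_assoc, X_mul_C]
  abel

/-- The column products of a product of two mutually commuting families factor through symmetric
tensors. -/
theorem rowProd_mul {A B : ℕ → Matrix (Fin 2) (Fin 2) R} {q : ℕ → R}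
    (h : ∀ j, IsManin (A j) (A (j + 1)) (q j)) (hc : ∀ i j, EntriesCommute (A i) (B j))
    {l : ℕ} (I : Fin l → Fin 2) :
    rowProd (fun j => A j * B j) l I =
      ∑ k ∈ Finset.range (l + 1),
        rowProd A l (stdIndex l k) * C ((rowProd B l I).coeff k) := by
  have hcomm : ∀ i j a b c, Commute (rowPoly (A i) a) (C (B j b c)) := by
    intro i j a b c
    have h0 : ∀ e, Commute (C (A i e a)) (C (B j b c)) := fun e => (hc i j e a b c).map C
    exact (h0 0).add_left ((h0 1).mul_left (X_mul_C _))
  have e : rowProd (fun j => A j * B j) l I =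
      ∑ E, rowProd A l (stdIndex l (weight E)) * C (word B l E I) := by
    simp only [rowProd, rowPoly_mul, prod_ofFn_sum]
    refine Finset.sum_congr rfl fun E _ => ?_
    rw [prod_ofFn_mul _ _ fun i j => hcomm _ _ _ _ _, prod_ofFn_C]
    congr 1
    exact rowProd_eq_stdIndex h E
  -- The `A`-part depends only on the weight of the intermediate index `E`; summing the `B`-part
  -- over all `E` of weight `k` gives a coefficient.
  rw [e, ← Finset.sum_fiberwise_of_maps_to (t := Finset.range (l + 1)) (g := weight)
    fun E _ => Finset.mem_range.2 (Nat.lt_succ_of_le (weight_le E))]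
  refine Finset.sum_congr rfl fun k _ => ?_
  rw [coeff_rowProd, map_sum, Finset.mul_sum]
  refine Finset.sum_congr rfl fun E hE => ?_
  rw [(Finset.mem_filter.1 hE).2]

/-- The average over permutations is the average over the orbit, which consists of all multi-indices
of the same weight. Denominators are cleared because `M` is only an additive monoid. -/
theorem sum_perm_comp {M : Type*} [AddCommMonoid M] {l : ℕ} (f : (Fin l → Fin 2) → M)
    (I : Fin l → Fin 2) :
    (Finset.univ.filter fun J : Fin l → Fin 2 => weight J = weight I).card •
        ∑ π : Equiv.Perm (Fin l), f (I ∘ π) =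
      l.factorial • ∑ J with weight J = weight I, f J := by
  have h1 : ∀ J ∈ Finset.univ.filter fun J : Fin l → Fin 2 => weight J = weight I,
      ∑ π : Equiv.Perm (Fin l), f (I ∘ π) = ∑ π : Equiv.Perm (Fin l), f (J ∘ π) := by
    intro J hJ
    obtain ⟨τ, rfl⟩ := exists_comp_perm_eq (Finset.mem_filter.1 hJ).2
    exact (Equiv.sum_comp (Equiv.mulLeft τ) fun π : Equiv.Perm (Fin l) => f (I ∘ π)).symm
  rw [← Finset.sum_const, Finset.sum_congr rfl h1, Finset.sum_comm]
  have h2 : ∀ π : Equiv.Perm (Fin l), ∑ J with weight J = weight I, f (J ∘ π) =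
      ∑ J with weight J = weight I, f J := by
    intro π
    simp only [Finset.sum_filter]
    rw [← Equiv.sum_comp (Equiv.arrowCongr π (Equiv.refl (Fin 2)))]
    refine Finset.sum_congr rfl fun J _ => ?_
    have : (Equiv.arrowCongr π (Equiv.refl (Fin 2)) J) ∘ π = J := by
      funext j
      simp [Equiv.arrowCongr]
    rw [this, ← weight_comp_perm _ π, this]
  rw [Finset.sum_congr rfl fun π _ => h2 π, Finset.sum_const, Finset.card_univ,
    Fintype.card_perm, Fintype.card_fin]

/-- The left side is `l!` times the trace of `P⁺ A₁ ⋯ A_l`. All `I` of weight `k` contribute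
equally, and their number cancels the size of the orbit in the average. -/
theorem sum_sum_perm_word [IsAddTorsionFree R] {A : ℕ → Matrix (Fin 2) (Fin 2) R} {q : ℕ → R}
    (h : ∀ j, IsManin (A j) (A (j + 1)) (q j)) (l : ℕ) :
    ∑ I : Fin l → Fin 2, ∑ π : Equiv.Perm (Fin l), word A l (I ∘ π) I =
      l.factorial • symTrace A l := by
  rw [symTrace, Finset.smul_sum, ← Finset.sum_fiberwise_of_maps_to (t := Finset.range (l + 1))
    (g := weight) fun E _ => Finset.mem_range.2 (Nat.lt_succ_of_le (weight_le E))]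
  refine Finset.sum_congr rfl fun k hk => ?_
  have hk : k ≤ l := Nat.lt_succ_iff.1 (Finset.mem_range.1 hk)
  set s := Finset.univ.filter fun J : Fin l → Fin 2 => weight J = k with hs
  have hcard : s.card ≠ 0 := by
    rw [Finset.card_ne_zero]
    exact ⟨stdIndex l k, by simp [hs, weight_stdIndex hk]⟩
  refine nsmul_right_injective hcard ?_
  change s.card • _ = s.card • _
  rw [Finset.smul_sum, ← Finset.sum_const]
  refine Finset.sum_congr rfl fun I hI => ?_
  obtain rfl : weight I = k := (Finset.mem_filter.1 hI).2
  rw [hs, sum_perm_comp (fun J => word A l J I), ← coeff_rowProd, ← rowProd_eq_stdIndex h]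

end Weights


/-! ### Operators on single tensor factors -/

section Embed

variable {κ : Type} [Fintype κ] [DecidableEq κ] {ι : κ → Type} [∀ k, DecidableEq (ι k)]

theorem embed_one {R : Type} [Ring R] (n : κ) :
    embed n (1 : Matrix (ι n) (ι n) R) = 1 := by
  ext h h'
  simp only [embed, Matrix.of_apply, Matrix.one_apply]
  by_cases e : h = h'
  · subst e
    simp
  · rw [if_neg e]
    split_ifs with h1 h2
    · refine absurd (funext fun k => ?_) e
      by_cases hk : k = n
      · subst hk
        exact h2
      · exact h1 k hk
    all_goals rfl

variable [∀ k, Fintype (ι k)]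

theorem sum_ite_agree_off {M : Type*} [AddCommMonoid M] (n : κ) (h : ∀ k, ι k)
    (f : (∀ k, ι k) → M) :
    ∑ K, (if ∀ k, k ≠ n → h k = K k then f K else 0) = ∑ x, f (Function.update h n x) := by
  rw [← Finset.sum_filter]
  refine Finset.sum_nbij' (fun K => K n) (fun x => Function.update h n x) ?_ ?_ ?_ ?_ ?_
  · intro K _
    exact Finset.mem_univ _
  · intro x _
    refine Finset.mem_filter.2 ⟨Finset.mem_univ _, fun k hk => ?_⟩
    rw [Function.update_of_ne hk]
  · intro K hK
    funext k
    by_cases hk : k = n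
    · subst hk
      rw [Function.update_self]
    · rw [Function.update_of_ne hk, (Finset.mem_filter.1 hK).2 k hk]
  · intro x _
    exact Function.update_self _ _ _
  · intro K hK
    congr 1
    funext k
    by_cases hk : k = n
    · subst hk
      rw [Function.update_self]
    · rw [Function.update_of_ne hk, (Finset.mem_filter.1 hK).2 k hk]

theorem embed_mul_apply {R : Type} [Ring R] (n : κ) (A : Matrix (ι n) (ι n) R)
    (Y : Matrix (∀ k, ι k) (∀ k, ι k) R) (h h' : ∀ k, ι k) :
    (embed n A * Y) h h' = ∑ x, A (h n) x * Y (Function.update h n x) h' := by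
  have := sum_ite_agree_off n h fun K => A (h n) (K n) * Y K h'
  simp only [Function.update_self] at this
  rw [Matrix.mul_apply, ← this]
  refine Finset.sum_congr rfl fun K _ => ?_
  simp [embed]

theorem embed_mul {R : Type} [Ring R] (n : κ) (A B : Matrix (ι n) (ι n) R) :
    embed n (A * B) = embed n A * embed n B := by
  ext h h'
  rw [embed_mul_apply]
  simp only [embed, Matrix.of_apply, Function.update_self, Matrix.mul_apply]
  have : ∀ x, (∀ k, k ≠ n → Function.update h n x k = h' k) ↔ ∀ k, k ≠ n → h k = h' k := by
    intro x
    refine forall_congr' fun k => forall_congr' fun hk => ?_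
    rw [Function.update_of_ne hk]
  simp only [this]
  split_ifs <;> simp

/-- `embed` as a homomorphism of algebras. -/
noncomputable def embedHom (n : κ) :
    Matrix (ι n) (ι n) ℂ →ₐ[ℂ] Matrix (∀ k, ι k) (∀ k, ι k) ℂ :=
  AlgHom.ofLinearMap
    { toFun := embed n
      map_add' := by
        intro A B
        ext h h'
        simp only [embed, Matrix.of_apply, Matrix.add_apply]
        split_ifs <;> simp
      map_smul' := by
        intro c A
        ext h h'
        simp [embed] }
    (embed_one n) (embed_mul n)

theorem embedHom_apply (n : κ) (A : Matrix (ι n) (ι n) ℂ) : embedHom n A = embed n A := rfl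

theorem commute_embed {n n' : κ} (hn : n ≠ n') (A : Matrix (ι n) (ι n) ℂ)
    (B : Matrix (ι n') (ι n') ℂ) : Commute (embed n A) (embed n' B) := by
  have key : ∀ {n n' : κ} (_ : n ≠ n') (A : Matrix (ι n) (ι n) ℂ) (B : Matrix (ι n') (ι n') ℂ)
      (h h' : ∀ k, ι k), (embed n A * embed n' B) h h' =
        if ∀ k, k ≠ n → k ≠ n' → h k = h' k then A (h n) (h' n) * B (h n') (h' n') else 0 := by
    intro n n' hn A B h h'
    rw [embed_mul_apply, Finset.sum_eq_single (h' n)]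
    · simp only [embed, Matrix.of_apply, Function.update_of_ne hn.symm, mul_ite, mul_zero]
      refine if_congr ⟨fun H k hk hk' => ?_, fun H k hk => ?_⟩ rfl rfl
      · rw [← H k hk', Function.update_of_ne hk]
      · by_cases hk' : k = n
        · subst hk'
          rw [Function.update_self]
        · rw [Function.update_of_ne hk', H k hk' hk]
    · intro x _ hx
      have : ¬ ∀ k, k ≠ n' → Function.update h n x k = h' k := by
        intro H
        exact hx (by simpa using H n hn)
      simp [embed, this]
    · simp
  ext h h'
  rw [key hn, key hn.symm]
  refine if_congr ⟨fun H k a b => H k b a, fun H k a b => H k b a⟩ (mul_comm _ _) rfl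

/-- The entries keep the order of the list, so the formula applies to monodromy matrices, whose
entries do not commute. -/
theorem list_prod_embed {R : Type} [Ring R] (A : ∀ k, Matrix (ι k) (ι k) R) :
    ∀ s : List κ, s.Nodup → ∀ h h' : ∀ k, ι k,
      (s.map fun k => embed k (A k)).prod h h' =
        if ∀ k, k ∉ s → h k = h' k then (s.map fun k => A k (h k) (h' k)).prod else 0
  | [], _, h, h' => by
    simp [Matrix.one_apply, funext_iff]
  | n :: s, hs, h, h' => by
    obtain ⟨hn, hs⟩ := List.nodup_cons.1 hs
    rw [List.map_cons, List.prod_cons, embed_mul_apply, Finset.sum_eq_single (h' n)]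
    · rw [list_prod_embed A s hs, List.map_cons, List.prod_cons, mul_ite, mul_zero]
      have e : (s.map fun k => A k (Function.update h n (h' n) k) (h' k)) =
          s.map fun k => A k (h k) (h' k) := by
        refine List.map_congr_left fun k hk => ?_
        rw [Function.update_of_ne]
        rintro rfl
        exact hn hk
      rw [e]
      refine if_congr ⟨fun H k hk => ?_, fun H k hk => ?_⟩ rfl rfl
      · rw [List.mem_cons, not_or] at hk
        rw [← H k hk.2, Function.update_of_ne hk.1]
      · by_cases hk' : k = n
        · subst hk'
          rw [Function.update_self]
        · rw [Function.update_of_ne hk', H k (by simp [hk', hk])]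
    · intro x _ hx
      rw [list_prod_embed A s hs, if_neg, mul_zero]
      intro H
      exact hx (by simpa using H n hn)
    · simp

end Embed

/-! ### The fused transfer matrix as a symmetric trace -/

section Fusion

theorem permOp_mul {l : ℕ} (π σ : Equiv.Perm (Fin l)) :
    permOp π * permOp σ = permOp (σ * π) := by
  ext j i
  rw [Matrix.mul_apply, Finset.sum_eq_single (i ∘ σ)]
  · simp only [permOp, Matrix.of_apply, if_true, mul_one, Equiv.Perm.coe_mul, Function.comp_assoc]
    exact if_congr Iff.rfl rfl rfl
  · intro k _ hk
    simp [permOp, hk]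
  · simp

theorem symProj_mul_self (l : ℕ) : symProj l * symProj l = symProj l := by
  have h : ∀ π : Equiv.Perm (Fin l),
      permOp π * ∑ σ : Equiv.Perm (Fin l), permOp σ = ∑ σ : Equiv.Perm (Fin l), permOp σ := by
    intro π
    simp only [Finset.mul_sum, permOp_mul]
    exact Equiv.sum_comp (Equiv.mulRight π) permOp
  rw [symProj, Matrix.smul_mul, Matrix.mul_smul, Finset.sum_mul, Finset.sum_congr rfl fun π _ => h π,
    Finset.sum_const, Finset.card_univ, Fintype.card_perm, Fintype.card_fin,
    ← Nat.cast_smul_eq_nsmul ℂ, smul_smul (l.factorial : ℂ)⁻¹ (l.factorial : ℂ),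
    inv_mul_cancel₀ (Nat.cast_ne_zero.2 l.factorial_ne_zero), one_smul]

theorem trace_symProj_mul {l : ℕ} (Y : Matrix (Fin l → Fin 2) (Fin l → Fin 2) ℂ) :
    (symProj l * Y).trace =
      (l.factorial : ℂ)⁻¹ * ∑ I : Fin l → Fin 2, ∑ π : Equiv.Perm (Fin l), Y (I ∘ π) I := by
  have h : ∀ π : Equiv.Perm (Fin l), (permOp π * Y).trace = ∑ I, Y (I ∘ π.symm) I := by
    intro π
    rw [Matrix.trace]
    refine Finset.sum_congr rfl fun I _ => ?_
    rw [Matrix.diag_apply, Matrix.mul_apply, Finset.sum_eq_single (I ∘ π.symm)]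
    · have : I = (I ∘ π.symm) ∘ π := by
        funext j
        simp
      simp only [permOp, Matrix.of_apply]
      rw [if_pos this, one_mul]
    · intro k _ hk
      have : ¬ I = k ∘ π := by
        rintro rfl
        exact hk (by funext j; simp)
      simp [permOp, this]
    · simp
  rw [symProj, Matrix.smul_mul, Matrix.trace_smul, Finset.sum_mul, Matrix.trace_sum,
    Finset.sum_congr rfl fun π _ => h π, Finset.sum_comm, smul_eq_mul]
  congr 1
  refine Finset.sum_congr rfl fun I _ => ?_
  exact Equiv.sum_comp (Equiv.inv (Equiv.Perm (Fin l))) fun π : Equiv.Perm (Fin l) => Y (I ∘ π) I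

variable {N : ℕ} (m : Fin N → ℕ)

theorem coeffAt_mul_auxOp {ι : Type} [Fintype ι] (A : Matrix ι ι ℂ) (Y : Matrix ι ι (Op m))
    (h h' : (n : Fin N) → Fin (m n + 1)) :
    coeffAt m (Y * auxOp m A) h h' = coeffAt m Y h h' * A := by
  ext i j
  simp [coeffAt, auxOp, Matrix.mul_apply, Matrix.sum_apply, mul_comm]

/-- The left factor `symProj l` puts the whole range inside `symSpace l`, so restriction loses no
trace. -/
theorem trace_restrict_symSpace {l : ℕ} (Y : Matrix (Fin l → Fin 2) (Fin l → Fin 2) ℂ)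
    (hY : ∀ v ∈ symSpace l, Matrix.toLin' (symProj l * Y) v ∈ symSpace l) :
    LinearMap.trace ℂ (symSpace l) ((Matrix.toLin' (symProj l * Y)).restrict hY) =
      (symProj l * Y).trace := by
  rw [LinearMap.trace_restrict_eq_of_forall_mem, Matrix.trace_toLin'_eq]
  intro v
  rw [Matrix.toLin'_mul]
  exact ⟨_, rfl⟩

theorem isAddTorsionFree_op : IsAddTorsionFree (Op m) where
  nsmul_right_injective := by
    intro n hn A B h
    ext i j
    have := congrFun (congrFun h i) j
    simpa [hn] using this

/-- The monodromy matrices which enter the fused transfer matrix of order `l`. -/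
noncomputable def monodromySeq (η : ℂ) (ξ : Fin N → ℂ) (K : Matrix (Fin 2) (Fin 2) ℂ) (l : ℕ)
    (u : ℂ) (j : ℕ) : Matrix (Fin 2) (Fin 2) (Op m) :=
  monodromy m η ξ K (u + ((l : ℂ) - 1 - j) * η)

theorem fusedTransfer_eq_symTrace (η : ℂ) (ξ : Fin N → ℂ) (K : Matrix (Fin 2) (Fin 2) ℂ) (l : ℕ)
    (u : ℂ) {q : ℕ → Op m}
    (h : ∀ j, IsManin (monodromySeq m η ξ K l u j) (monodromySeq m η ξ K l u (j + 1)) (q j)) :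
    fusedTransfer m η ξ K l u = symTrace (monodromySeq m η ξ K l u) l := by
  have := isAddTorsionFree_op m
  have key := sum_sum_perm_word h l
  set A := monodromySeq m η ξ K l u with hA
  have hW : (List.ofFn fun j : Fin l =>
        embed (ι := fun _ : Fin l => Fin 2) j
          (monodromy m η ξ K (u + ((l : ℂ) - 1 - (j : ℕ)) * η))).prod =
      Matrix.of fun J I => word A l J I := by
    ext1 J I
    rw [List.ofFn_eq_map, list_prod_embed (ι := fun _ : Fin l => Fin 2)
      (fun j => monodromy m η ξ K (u + ((l : ℂ) - 1 - (j : ℕ)) * η)) _ (List.nodup_finRange l),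
      if_pos fun k hk => absurd (List.mem_finRange k) hk, ← List.ofFn_eq_map]
    rfl
  ext h h'
  rw [fusedTransfer, Matrix.of_apply]
  have e : coeffAt m (fusedMonodromy m η ξ K l u) h h' =
      symProj l * (coeffAt m (Matrix.of fun J I => word A l J I) h h' * symProj l) := by
    rw [fusedMonodromy, coeffAt_auxOp_mul, coeffAt_mul_auxOp, hW]
  simp only [e]
  -- Cyclicity of the trace and idempotence remove the right projector.
  rw [trace_restrict_symSpace, ← mul_assoc, Matrix.trace_mul_comm, ← mul_assoc, symProj_mul_self,
    trace_symProj_mul]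
  have key' := congrFun (congrFun key h) h'
  rw [← Nat.cast_smul_eq_nsmul ℂ, Matrix.smul_apply] at key'
  simp only [Matrix.sum_apply] at key'
  simp only [coeffAt, Matrix.map_apply, Matrix.of_apply]
  rw [key', smul_eq_mul, ← mul_assoc, inv_mul_cancel₀ (Nat.cast_ne_zero.2 l.factorial_ne_zero),
    one_mul]

end Fusion


/-! ### Relations of the spin matrices -/

section Spin

theorem spinZ_mul_spinPlus (p : ℕ) :
    spinZ p * spinPlus p - spinPlus p * spinZ p = spinPlus p := by
  ext i j
  simp only [spinZ, spinPlus, Matrix.sub_apply, Matrix.diagonal_mul, Matrix.mul_diagonal,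
    Matrix.of_apply]
  split_ifs with h
  · rw [h]
    push_cast
    ring
  · simp

theorem spinZ_mul_spinMinus (p : ℕ) :
    spinZ p * spinMinus p - spinMinus p * spinZ p = -spinMinus p := by
  have h := congrArg Matrix.transpose (spinZ_mul_spinPlus p)
  have hZ : (spinZ p).transpose = spinZ p := Matrix.diagonal_transpose _
  rw [Matrix.transpose_sub, Matrix.transpose_mul, Matrix.transpose_mul, hZ] at h
  rw [spinMinus]
  linear_combination (norm := module) -h

theorem sqrt_mul_sqrt_cast {x : ℝ} (hx : 0 ≤ x) :
    ((Real.sqrt x : ℝ) : ℂ) * ((Real.sqrt x : ℝ) : ℂ) = x := by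
  rw [← Complex.ofReal_mul, Real.mul_self_sqrt hx]

theorem spinPlus_mul_spinMinus (p : ℕ) :
    spinPlus p * spinMinus p =
      Matrix.diagonal fun i : Fin (p + 1) => (((i : ℕ) : ℂ) + 1) * ((p : ℂ) - (i : ℕ)) := by
  ext i j
  rw [Matrix.mul_apply]
  simp only [spinPlus, spinMinus, Matrix.transpose_apply, Matrix.of_apply]
  by_cases hij : i = j
  · subst hij
    rw [Matrix.diagonal_apply_eq]
    by_cases hi : (i : ℕ) < p
    · rw [Finset.sum_eq_single ⟨(i : ℕ) + 1, by omega⟩]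
      · rw [if_pos rfl, sqrt_mul_sqrt_cast]
        · push_cast
          ring
        · have : ((i : ℕ) : ℝ) + 1 ≤ p := by exact_mod_cast hi
          exact mul_nonneg (by positivity) (by linarith)
      · intro k _ hk
        rw [if_neg fun h => hk (Fin.ext h), zero_mul]
      · simp
    -- The last row of `spinPlus` is zero, in agreement with the factor `p - i`.
    · have hi' : (i : ℕ) = p := by omega
      have hz : (((i : ℕ) : ℂ) + 1) * ((p : ℂ) - (i : ℕ)) = 0 := by rw [hi', sub_self, mul_zero]
      rw [hz]
      refine Finset.sum_eq_zero fun k _ => ?_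
      have := k.2
      rw [if_neg (by omega), zero_mul]
  · rw [Matrix.diagonal_apply_ne _ hij]
    refine Finset.sum_eq_zero fun k _ => ?_
    split_ifs with h1 h2
    · exact absurd (Fin.ext (by omega)) hij
    all_goals simp

theorem spinMinus_mul_spinPlus (p : ℕ) :
    spinMinus p * spinPlus p =
      Matrix.diagonal fun i : Fin (p + 1) => ((i : ℕ) : ℂ) * ((p : ℂ) + 1 - (i : ℕ)) := by
  ext i j
  rw [Matrix.mul_apply]
  simp only [spinPlus, spinMinus, Matrix.transpose_apply, Matrix.of_apply]
  by_cases hij : i = j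
  · subst hij
    rw [Matrix.diagonal_apply_eq]
    by_cases hi : (i : ℕ) = 0
    · rw [hi, Nat.cast_zero, zero_mul]
      refine Finset.sum_eq_zero fun k _ => ?_
      rw [if_neg (by omega), zero_mul]
    · rw [Finset.sum_eq_single ⟨(i : ℕ) - 1, by omega⟩]
      · have e : (((i : ℕ) - 1 : ℕ) : ℝ) + 1 = (i : ℕ) := by
          rw [Nat.cast_sub (by omega)]
          push_cast
          ring
        rw [if_pos (by simp; omega), sqrt_mul_sqrt_cast]
        · rw [e]
          push_cast
          ring
        · have : ((i : ℕ) : ℝ) ≤ p := by exact_mod_cast Nat.lt_succ_iff.1 i.2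
          rw [e]
          exact mul_nonneg (by positivity) (by linarith)
      · intro k _ hk
        rw [if_neg fun h => hk (Fin.ext (by simp; omega)), zero_mul]
      · simp
  · rw [Matrix.diagonal_apply_ne _ hij]
    refine Finset.sum_eq_zero fun k _ => ?_
    split_ifs with h1 h2
    · exact absurd (Fin.ext (by omega)) hij
    all_goals simp

theorem spin_commutator (p : ℕ) :
    spinPlus p * spinMinus p - spinMinus p * spinPlus p = (2 : ℂ) • spinZ p := by
  rw [spinPlus_mul_spinMinus, spinMinus_mul_spinPlus, spinZ, Matrix.diagonal_sub,
    ← Matrix.diagonal_smul]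
  congr 1
  funext i
  simp
  ring

theorem spin_casimir (p : ℕ) :
    spinZ p * spinZ p + spinZ p + spinMinus p * spinPlus p =
      ((p : ℂ) / 2 * ((p : ℂ) / 2 + 1)) • (1 : Matrix (Fin (p + 1)) (Fin (p + 1)) ℂ) := by
  rw [spinMinus_mul_spinPlus, spinZ, Matrix.diagonal_mul_diagonal, Matrix.diagonal_add,
    Matrix.diagonal_add, Matrix.smul_one_eq_diagonal]
  congr 1
  funext i
  ring

end Spin

/-! ### The RTT relation and commuting traces -/

section RTT

variable {R : Type*} [Ring R] [Algebra ℂ R]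

/-- The relation `R(x) (A ⊗ 1) (1 ⊗ B) = (1 ⊗ B) (A ⊗ 1) R(x)` for the rational `R`-matrix
`R(x) = x + η P`, in components. -/
def IsRTT (x η : ℂ) (A B : Matrix (Fin 2) (Fin 2) R) : Prop :=
  ∀ i j k l, x • (A i j * B k l) + η • (A k j * B i l) = x • (B k l * A i j) + η • (B k j * A i l)

/-- The `R`-matrix is carried first past `A, A'` and then, acting on the intermediate indices, past
`B, B'`. -/
theorem IsRTT.mul {x η : ℂ} {A A' B B' : Matrix (Fin 2) (Fin 2) R} (hA : IsRTT x η A A')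
    (hB : IsRTT x η B B') (hc : EntriesCommute A' B) (hc' : EntriesCommute A B') :
    IsRTT x η (A * B) (A' * B') := by
  intro i j k l
  have key : ∀ {A A' B B' : Matrix (Fin 2) (Fin 2) R}, EntriesCommute A' B → ∀ i j k l,
      (A * B) i j * (A' * B') k l = ∑ e, ∑ f, A i e * A' k f * (B e j * B' f l) := by
    intro A A' B B' hc i j k l
    simp only [Matrix.mul_apply, Finset.sum_mul_sum]
    refine Finset.sum_congr rfl fun e _ => Finset.sum_congr rfl fun f _ => ?_
    rw [mul_assoc, mul_assoc, ← mul_assoc (B e j), ← (hc k f e j).eq, mul_assoc]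
  have h1 : x • ((A * B) i j * (A' * B') k l) + η • ((A * B) k j * (A' * B') i l) =
      ∑ e, ∑ f, (x • (A i e * A' k f) + η • (A k e * A' i f)) * (B e j * B' f l) := by
    simp only [key hc, Finset.smul_sum, ← Finset.sum_add_distrib, add_mul, smul_mul_assoc]
  have h2 : ∑ e, ∑ f, (x • (A i e * A' k f) + η • (A k e * A' i f)) * (B e j * B' f l) =
      ∑ e, ∑ f, A' k f * A i e * (x • (B e j * B' f l) + η • (B f j * B' e l)) := by
    simp only [hA _ _ _ _, Fin.sum_univ_two, add_mul, mul_add, smul_mul_assoc, mul_smul_comm]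
    abel
  have h3 : x • ((A' * B') k l * (A * B) i j) + η • ((A' * B') k j * (A * B) i l) =
      ∑ e, ∑ f, A' k f * A i e * (x • (B' f l * B e j) + η • (B' f j * B e l)) := by
    simp only [key hc', Fin.sum_univ_two, mul_add, smul_add, mul_smul_comm]
    abel
  rw [h1, h2, h3]
  simp only [hB _ _ _ _]

theorem IsRTT.one (x η : ℂ) : IsRTT x η (1 : Matrix (Fin 2) (Fin 2) R) 1 := by
  intro i j k l
  simp only [Matrix.one_apply]
  fin_cases i <;> fin_cases j <;> fin_cases k <;> fin_cases l <;> simp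

/-- Inverting `R(x)` would exclude `x = ±η`. Instead, put `Y = [tr A, tr B]` and let `Z` be the
double sum in `e1`. Contracting indices gives `xY = ηZ`, `xZ = -ηY` and `xZ = ηY`, so `ηY = 0` and
`x²Y = 0`. -/
theorem IsRTT.trace_commute {x η : ℂ} {A B : Matrix (Fin 2) (Fin 2) R} (h : IsRTT x η A B)
    (h' : IsRTT (-x) η B A) (hne : x ≠ 0 ∨ η ≠ 0) : Commute A.trace B.trace := by
  have e1 : x • (A.trace * B.trace - B.trace * A.trace) =
      η • ∑ i, ∑ k, (B k i * A i k - A k i * B i k) := by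
    have := fun i k => h i i k k
    simp only [Matrix.trace_fin_two, Fin.sum_univ_two, add_mul, mul_add]
    linear_combination (norm := module) this 0 0 + this 0 1 + this 1 0 + this 1 1
  have e2 : x • ∑ i, ∑ k, (B k i * A i k - A k i * B i k) =
      -(η • (A.trace * B.trace - B.trace * A.trace)) := by
    have := fun i k => h' k i i k
    simp only [Matrix.trace_fin_two, Fin.sum_univ_two, add_mul, mul_add]
    linear_combination (norm := module) -(this 0 0 + this 0 1 + this 1 0 + this 1 1)
  have e3 : x • ∑ i, ∑ k, (B k i * A i k - A k i * B i k) =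
      η • (A.trace * B.trace - B.trace * A.trace) := by
    have := fun i k => h i k k i
    simp only [Matrix.trace_fin_two, Fin.sum_univ_two, add_mul, mul_add]
    linear_combination (norm := module) -(this 0 0 + this 0 1 + this 1 0 + this 1 1)
  set Y := A.trace * B.trace - B.trace * A.trace with hY
  have hη : η • Y = 0 := by
    have : (2 : ℂ) • η • Y = 0 := by
      linear_combination (norm := module) e2 - e3
    simpa using this
  have hx : x • x • Y = 0 := by
    rw [e1, smul_comm, e3, hη, smul_zero]
  have : Y = 0 := by
    rcases hne with hne | hne
    · simpa [hne] using hx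
    · simpa [hne] using hη
  exact sub_eq_zero.1 this

end RTT


/-! ### The Lax matrix of one spin -/

section Lax

variable {R : Type*} [Ring R] [Algebra ℂ R]

/-- The relations of the spin `s` operators, where `s (s + 1)` is the value of the Casimir. -/
structure IsSpinTriple (s : ℂ) (z p n : R) : Prop where
  z_p : z * p - p * z = p
  z_n : z * n - n * z = -n
  p_n : p * n - n * p = (2 : ℂ) • z
  casimir : z * z + z + n * p = (s * (s + 1)) • (1 : R)

/-- The Lax matrix `w + η σ·S`. -/
def laxMatrix (η w : ℂ) (z p n : R) : Matrix (Fin 2) (Fin 2) R :=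
  !![w • 1 + η • z, η • n; η • p, w • 1 - η • z]

variable {s : ℂ} {z p n : R}

/-- The spin relations in `gl₂` form: for a matrix linear in its parameter, the RTT relation reduces
to exactly these. -/
theorem IsSpinTriple.commutator (h : IsSpinTriple s z p n) (i j k l : Fin 2) :
    (!![z, n; p, -z] : Matrix (Fin 2) (Fin 2) R) i j *
        (!![z, n; p, -z] : Matrix (Fin 2) (Fin 2) R) k l -
      (!![z, n; p, -z] : Matrix (Fin 2) (Fin 2) R) k l *
        (!![z, n; p, -z] : Matrix (Fin 2) (Fin 2) R) i j =
    (1 : Matrix (Fin 2) (Fin 2) ℂ) i l • (!![z, n; p, -z] : Matrix (Fin 2) (Fin 2) R) k j -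
      (1 : Matrix (Fin 2) (Fin 2) ℂ) k j • (!![z, n; p, -z] : Matrix (Fin 2) (Fin 2) R) i l := by
  obtain ⟨h1, h2, h3, -⟩ := h
  rw [sub_eq_iff_eq_add] at h1 h2 h3
  fin_cases i <;> fin_cases j <;> fin_cases k <;> fin_cases l <;> simp [h1, h2, h3] <;> module

theorem laxMatrix_apply (η w : ℂ) (i j : Fin 2) :
    laxMatrix η w z p n i j = (w * (1 : Matrix (Fin 2) (Fin 2) ℂ) i j) • 1 +
      η • (!![z, n; p, -z] : Matrix (Fin 2) (Fin 2) R) i j := by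
  fin_cases i <;> fin_cases j <;> simp [laxMatrix, sub_eq_add_neg]

theorem IsSpinTriple.isRTT (h : IsSpinTriple s z p n) (η v w : ℂ) :
    IsRTT (v - w) η (laxMatrix η v z p n) (laxMatrix η w z p n) := by
  intro i j k l
  have hc := h.commutator i j k l
  simp only [laxMatrix_apply]
  generalize (!![z, n; p, -z] : Matrix (Fin 2) (Fin 2) R) = S at hc ⊢
  simp only [add_mul, mul_add, smul_mul_assoc, mul_smul_comm, one_mul, mul_one]
  linear_combination (norm := module) ((v - w) * η ^ 2) • hc

/-- For equal row indices this is a commutator of `z` with `n` or `p`; for different ones the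
Casimir makes the quantum determinant a scalar. -/
theorem IsSpinTriple.isManin (h : IsSpinTriple s z p n) (η w : ℂ) :
    IsManin (laxMatrix η (w + η) z p n) (laxMatrix η w z p n)
      (((w + η + s * η) * (w - s * η)) • (1 : R)) := by
  obtain ⟨h1, h2, h3, h4⟩ := h
  intro i j
  fin_cases i <;> fin_cases j <;>
  simp [laxMatrix, add_mul, mul_add, sub_mul, mul_sub, smul_smul, smul_sub]
  · linear_combination (norm := module) (η ^ 2) • h2
  · linear_combination (norm := module) (-η ^ 2) • h4
  · linear_combination (norm := module) (η ^ 2) • (h4 + h3)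
  · linear_combination (norm := module) (η ^ 2) • h1

end Lax


/-! ### A derivation expressing covariance under the raising operator -/

section TwistedDerivative

variable {R : Type*} [Ring R]

/-- The derivation `f ↦ f' + [p, f]`. -/
noncomputable def twistedDeriv (p : R) : R[X] →+ R[X] :=
  (derivative : R[X] →ₗ[R] R[X]).toAddMonoidHom + AddMonoidHom.mulLeft (C p) -
    AddMonoidHom.mulRight (C p)

theorem twistedDeriv_apply (p : R) (f : R[X]) :
    twistedDeriv p f = derivative f + C p * f - f * C p := rfl

theorem twistedDeriv_mul (p : R) (f g : R[X]) :
    twistedDeriv p (f * g) = twistedDeriv p f * g + f * twistedDeriv p g := by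
  simp only [twistedDeriv_apply, derivative_mul]
  noncomm_ring

theorem twistedDeriv_one (p : R) : twistedDeriv p 1 = 0 := by
  simp [twistedDeriv_apply]

theorem twistedDeriv_linear (p a b : R) :
    twistedDeriv p (C a + C b * X) = C (b + (p * a - a * p)) + C (p * b - b * p) * X := by
  have e : C b * X * C p = C b * C p * X := by rw [mul_assoc, X_mul_C, mul_assoc]
  rw [twistedDeriv_apply, mul_add, add_mul, e]
  simp only [derivative_add, derivative_C, derivative_C_mul, derivative_X, C_add, C_sub, C_mul,
    mul_one, zero_add, ← mul_assoc, sub_mul]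
  abel

theorem closure_rowProd_mul_mem (A : ℕ → Matrix (Fin 2) (Fin 2) R) (l : ℕ) (c : Fin 2) {f : R[X]}
    (hf : f ∈ AddSubgroup.closure (Set.range (rowProd A l))) :
    f * rowPoly (A l) c ∈ AddSubgroup.closure (Set.range (rowProd A (l + 1))) := by
  induction hf using AddSubgroup.closure_induction with
  | mem f hf =>
    obtain ⟨I, rfl⟩ := hf
    refine AddSubgroup.subset_closure ⟨Fin.snoc I c, ?_⟩
    rw [rowProd_succ]
    simp
  | zero => simp
  | add f g _ _ hf hg =>
    rw [add_mul]
    exact add_mem hf hg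
  | neg f _ hf =>
    rw [neg_mul]
    exact neg_mem hf

/-- By the Leibniz rule, the derivation of a product is the sum of the products in which one column
`1` is replaced by column `0`. -/
theorem twistedDeriv_closure_rowProd {A : ℕ → Matrix (Fin 2) (Fin 2) R} {p : R}
    (h0 : ∀ j, twistedDeriv p (rowPoly (A j) 0) = 0)
    (h1 : ∀ j, twistedDeriv p (rowPoly (A j) 1) = rowPoly (A j) 0) (l : ℕ) {f : R[X]}
    (hf : f ∈ AddSubgroup.closure (Set.range (rowProd A l))) :
    twistedDeriv p f ∈ AddSubgroup.closure (Set.range (rowProd A l)) := by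
  have key : ∀ l (I : Fin l → Fin 2),
      twistedDeriv p (rowProd A l I) ∈ AddSubgroup.closure (Set.range (rowProd A l)) := by
    intro l
    induction l with
    | zero =>
      intro I
      rw [rowProd_zero, twistedDeriv_one]
      exact zero_mem _
    | succ l ih =>
      intro I
      rw [rowProd_succ, twistedDeriv_mul]
      refine add_mem (closure_rowProd_mul_mem A l _ (ih _)) ?_
      generalize I (Fin.last l) = c
      fin_cases c
      · simp only [Fin.zero_eta, h0, mul_zero]
        exact zero_mem _
      · simp only [Fin.mk_one, h1]
        exact closure_rowProd_mul_mem A l 0 (AddSubgroup.subset_closure ⟨_, rfl⟩)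
  induction hf using AddSubgroup.closure_induction with
  | mem f hf =>
    obtain ⟨I, rfl⟩ := hf
    exact key l I
  | zero =>
    rw [map_zero]
    exact zero_mem _
  | add f g _ _ hf hg =>
    rw [map_add]
    exact add_mem hf hg
  | neg f _ hf =>
    rw [map_neg]
    exact neg_mem hf

variable [Algebra ℂ R]

/-- A family of products stable under the twisted derivation vanishes if all its constant terms
do. -/
theorem rowProd_eq_zero_of_coeff_zero {A : ℕ → Matrix (Fin 2) (Fin 2) R} {p : R}
    (h0 : ∀ j, twistedDeriv p (rowPoly (A j) 0) = 0)
    (h1 : ∀ j, twistedDeriv p (rowPoly (A j) 1) = rowPoly (A j) 0) {l : ℕ}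
    (hA : ∀ I : Fin l → Fin 2, (rowProd A l I).coeff 0 = 0) (I : Fin l → Fin 2) :
    rowProd A l I = 0 := by
  have key : ∀ k, ∀ f ∈ AddSubgroup.closure (Set.range (rowProd A l)), f.coeff k = 0 := by
    intro k
    induction k with
    | zero =>
      intro f hf
      induction hf using AddSubgroup.closure_induction with
      | mem f hf =>
        obtain ⟨I, rfl⟩ := hf
        exact hA I
      | zero => simp
      | add f g _ _ hf hg => rw [coeff_add, hf, hg, add_zero]
      | neg f _ hf => rw [coeff_neg, hf, neg_zero]
    | succ k ih =>
      intro f hf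
      -- The coefficient of `X^k` in `f' + [p, f]` is `(k + 1) f_(k+1) + [p, f_k]`, and `f_k = 0` by
      -- induction.
      have h := ih _ (twistedDeriv_closure_rowProd h0 h1 l hf)
      rw [twistedDeriv_apply, coeff_sub, coeff_add, coeff_C_mul, coeff_mul_C, ih f hf, mul_zero,
        zero_mul, add_zero, sub_zero, coeff_derivative] at h
      have h' : ((k : ℂ) + 1) • f.coeff (k + 1) = 0 := by
        rw [← h, add_smul, one_smul, mul_add, mul_one, Nat.cast_smul_eq_nsmul, nsmul_eq_mul,
          Nat.cast_comm]
      exact (smul_eq_zero.1 h').resolve_left (Nat.cast_add_one_ne_zero k)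
  ext k
  rw [key k _ (AddSubgroup.subset_closure ⟨I, rfl⟩), coeff_zero]

variable {s : ℂ} {z p n : R}

/-- The Lax matrix is invariant under rotations of both spins: raising the row index by `d/dX` and
commuting with `S⁺` amounts to raising the column index, and column `0` is already highest. -/
theorem IsSpinTriple.twistedDeriv_rowPoly_zero (h : IsSpinTriple s z p n) (η w : ℂ) :
    twistedDeriv p (rowPoly (laxMatrix η w z p n) 0) = 0 := by
  have h1 := h.z_p
  have e1 : η • p + (p * (w • 1 + η • z) - (w • 1 + η • z) * p) = 0 := by
    simp only [mul_add, add_mul, mul_smul_comm, smul_mul_assoc, one_mul, mul_one]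
    linear_combination (norm := module) -(η • h1)
  have e2 : p * (η • p) - (η • p) * p = 0 := by simp
  have := twistedDeriv_linear p (w • 1 + η • z) (η • p)
  rw [e1, e2] at this
  simpa [rowPoly, laxMatrix] using this

theorem IsSpinTriple.twistedDeriv_rowPoly_one (h : IsSpinTriple s z p n) (η w : ℂ) :
    twistedDeriv p (rowPoly (laxMatrix η w z p n) 1) = rowPoly (laxMatrix η w z p n) 0 := by
  have h1 := h.z_p
  have h3 := h.p_n
  have e1 : w • 1 - η • z + (p * (η • n) - (η • n) * p) = w • 1 + η • z := by
    simp only [mul_smul_comm, smul_mul_assoc]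
    linear_combination (norm := module) η • h3
  have e2 : p * (w • 1 - η • z) - (w • 1 - η • z) * p = η • p := by
    simp only [mul_sub, sub_mul, mul_smul_comm, smul_mul_assoc, one_mul, mul_one]
    linear_combination (norm := module) η • h1
  have := twistedDeriv_linear p (η • n) (w • 1 - η • z)
  rw [e1, e2] at this
  simpa [rowPoly, laxMatrix] using this

end TwistedDerivative

/-! ### Constant terms at one site -/

section LowestComponent

/-- A product of `r` factors maps into the span of the basis vectors from the `r`-th on. -/
theorem prod_laxMatrix_apply_eq_zero (η : ℂ) (P : ℕ) : ∀ (r : ℕ) (I : Fin r → Fin 2)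
    (i i' : Fin (P + 1)), (i : ℕ) < r →
    (List.ofFn fun j : Fin r => laxMatrix η (((r : ℂ) - 1 - (j : ℕ) - (P : ℂ) / 2) * η)
      (spinZ P) (spinPlus P) (spinMinus P) 0 (I j)).prod i i' = 0 := by
  intro r
  induction r with
  | zero => intro I i i' hi; omega
  | succ r ih =>
    intro I i i' hi
    have e : ∀ j : Fin r, ((r + 1 : ℕ) : ℂ) - 1 - (j.succ : ℕ) = (r : ℂ) - 1 - (j : ℕ) := by
      intro j
      push_cast [Fin.val_succ]
      ring
    rw [List.ofFn_succ, List.prod_cons]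
    simp only [e]
    have ih' := fun i h => ih (fun j => I j.succ) i i' h
    generalize (List.ofFn fun j : Fin r => laxMatrix η (((r : ℂ) - 1 - (j : ℕ) - (P : ℂ) / 2) * η)
      (spinZ P) (spinPlus P) (spinMinus P) 0 (I j.succ)).prod = Y at ih' ⊢
    generalize I 0 = c
    fin_cases c
    -- The leftmost diagonal factor has entries `η (r - i)`: it kills precisely the row `r` which
    -- the induction hypothesis leaves open.
    · have e0 : laxMatrix η ((((r + 1 : ℕ) : ℂ) - 1 - ((0 : Fin (r + 1)) : ℕ) - (P : ℂ) / 2) * η)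
          (spinZ P) (spinPlus P) (spinMinus P) 0 0 =
          Matrix.diagonal fun i : Fin (P + 1) => η * ((r : ℂ) - (i : ℕ)) := by
        simp only [laxMatrix, Matrix.of_apply, Matrix.cons_val_zero, Matrix.cons_val', spinZ,
          Matrix.smul_one_eq_diagonal, ← Matrix.diagonal_smul, Matrix.diagonal_add]
        congr 1
        funext i
        simp
        ring
      simp only [Fin.zero_eta]
      rw [e0, Matrix.diagonal_mul]
      rcases (Nat.lt_succ_iff.1 hi).lt_or_eq with hlt | heq
      · rw [ih' i hlt, mul_zero]
      · rw [heq, sub_self, mul_zero, zero_mul]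
    · simp only [Fin.mk_one]
      -- Row `i` of `S⁻ Y` involves only row `i - 1` of `Y`, which vanishes by induction; row `0` of
      -- `S⁻` is zero.
      rw [Matrix.mul_apply]
      refine Finset.sum_eq_zero fun k _ => ?_
      simp only [laxMatrix, Matrix.of_apply, Matrix.cons_val_zero, Matrix.cons_val_one,
        Matrix.cons_val', Matrix.cons_val_fin_one, Matrix.smul_apply, spinMinus,
        Matrix.transpose_apply, spinPlus]
      split_ifs with hk
      · rw [ih' k (by omega), mul_zero]
      · simp

end LowestComponent


/-! ### Relations for the whole chain -/

section ChainRelations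

variable {N : ℕ} (m : Fin N → ℕ)

theorem IsSpinTriple.map {R S : Type*} [Ring R] [Algebra ℂ R] [Ring S] [Algebra ℂ S] {s : ℂ}
    {z p n : R} (h : IsSpinTriple s z p n) (φ : R →ₐ[ℂ] S) :
    IsSpinTriple s (φ z) (φ p) (φ n) where
  z_p := by simpa using congrArg φ h.z_p
  z_n := by simpa using congrArg φ h.z_n
  p_n := by simpa only [map_sub, map_mul, map_smul] using congrArg φ h.p_n
  casimir := by
    simpa only [map_add, map_mul, map_smul, map_one] using congrArg φ h.casimir

theorem laxMatrix_map {R S : Type*} [Ring R] [Algebra ℂ R] [Ring S] [Algebra ℂ S] (η w : ℂ)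
    (z p n : R) (φ : R →ₐ[ℂ] S) (i j : Fin 2) :
    φ (laxMatrix η w z p n i j) = laxMatrix η w (φ z) (φ p) (φ n) i j := by
  simp only [laxMatrix_apply, map_add, map_smul, map_one]
  fin_cases i <;> fin_cases j <;> simp

theorem isSpinTriple_spin (p : ℕ) :
    IsSpinTriple ((p : ℂ) / 2) (spinZ p) (spinPlus p) (spinMinus p) where
  z_p := spinZ_mul_spinPlus p
  z_n := spinZ_mul_spinMinus p
  p_n := spin_commutator p
  casimir := spin_casimir p

theorem isSpinTriple_embed (n : Fin N) :
    IsSpinTriple (R := Op m) ((m n : ℂ) / 2) (embed n (spinZ (m n))) (embed n (spinPlus (m n)))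
      (embed n (spinMinus (m n))) :=
  (isSpinTriple_spin (m n)).map (embedHom (ι := fun k => Fin (m k + 1)) n)

theorem lax_eq_laxMatrix (η : ℂ) (n : Fin N) (u : ℂ) :
    lax m η n u = laxMatrix (R := Op m) η (u + η / 2) (embed n (spinZ (m n)))
      (embed n (spinPlus (m n))) (embed n (spinMinus (m n))) := by
  have e : ∀ A : Matrix (Fin (m n + 1)) (Fin (m n + 1)) ℂ,
      (embed n A : Op m) = embedHom (ι := fun k => Fin (m k + 1)) n A := fun A => rfl
  simp only [lax, laxMatrix, e, map_add, map_sub, map_smul, map_one]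

theorem exists_lax_apply_eq_embed (η : ℂ) (n : Fin N) (u : ℂ) (a b : Fin 2) :
    ∃ A : Matrix (Fin (m n + 1)) (Fin (m n + 1)) ℂ, lax m η n u a b = embed n A := by
  rw [lax]
  match a, b with
  | 0, 0 => exact ⟨_, rfl⟩
  | 0, 1 => exact ⟨_, rfl⟩
  | 1, 0 => exact ⟨_, rfl⟩
  | 1, 1 => exact ⟨_, rfl⟩

theorem lax_entriesCommute (η : ℂ) {n n' : Fin N} (hn : n ≠ n') (u v : ℂ) :
    EntriesCommute (lax m η n u) (lax m η n' v) := by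
  intro a b c d
  obtain ⟨A, hA⟩ := exists_lax_apply_eq_embed m η n u a b
  obtain ⟨B, hB⟩ := exists_lax_apply_eq_embed m η n' v c d
  have := commute_embed (ι := fun k => Fin (m k + 1)) hn A B
  rw [hA, hB]
  exact this

theorem auxOp_entriesCommute (K : Matrix (Fin 2) (Fin 2) ℂ) (X : Matrix (Fin 2) (Fin 2) (Op m)) :
    EntriesCommute (auxOp m K) X := by
  intro a b c d
  exact (Commute.one_left (X c d)).smul_left (K a b)

theorem auxOp_isManin (K : Matrix (Fin 2) (Fin 2) ℂ) :
    IsManin (auxOp m K) (auxOp m K) (K.det • (1 : Op m)) := by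
  intro i j
  fin_cases i <;> fin_cases j <;> simp [auxOp, Matrix.det_fin_two] <;> module

theorem auxOp_isRTT (x η : ℂ) (K : Matrix (Fin 2) (Fin 2) ℂ) :
    IsRTT x η (auxOp m K) (auxOp m K) := by
  intro i j k l
  simp only [auxOp, Matrix.map_apply, mul_smul_comm, mul_one]
  module

/-- The ordered product of the Lax operators at a list of sites. -/
noncomputable def laxProd (η : ℂ) (ξ : Fin N → ℂ) (s : List (Fin N)) (u : ℂ) :
    Matrix (Fin 2) (Fin 2) (Op m) :=
  (s.map fun n => lax m η n (u - ξ n)).prod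

theorem laxProd_cons (η : ℂ) (ξ : Fin N → ℂ) (n : Fin N) (s : List (Fin N)) (u : ℂ) :
    laxProd m η ξ (n :: s) u = lax m η n (u - ξ n) * laxProd m η ξ s u := by
  simp [laxProd]

theorem lax_laxProd_entriesCommute (η : ℂ) (ξ : Fin N → ℂ) {n : Fin N} {s : List (Fin N)}
    (hn : n ∉ s) (u v : ℂ) : EntriesCommute (lax m η n u) (laxProd m η ξ s v) := by
  refine EntriesCommute.list_prod_right _ fun B hB => ?_
  obtain ⟨n', hn', rfl⟩ := List.mem_map.1 hB
  refine lax_entriesCommute m η ?_ _ _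
  rintro rfl
  exact hn hn'

theorem laxProd_isRTT (η : ℂ) (ξ : Fin N → ℂ) (u v : ℂ) : ∀ s : List (Fin N), s.Nodup →
    IsRTT (u - v) η (laxProd m η ξ s u) (laxProd m η ξ s v)
  | [], _ => by simpa [laxProd] using IsRTT.one (u - v) η
  | n :: s, hs => by
    obtain ⟨hn, hs⟩ := List.nodup_cons.1 hs
    rw [laxProd_cons, laxProd_cons]
    refine IsRTT.mul ?_ (laxProd_isRTT η ξ u v s hs)
      (lax_laxProd_entriesCommute m η ξ hn _ _) (lax_laxProd_entriesCommute m η ξ hn _ _)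
    rw [lax_eq_laxMatrix, lax_eq_laxMatrix]
    have := (isSpinTriple_embed m n).isRTT η (u - ξ n + η / 2) (v - ξ n + η / 2)
    rwa [show u - ξ n + η / 2 - (v - ξ n + η / 2) = u - v by ring] at this

theorem laxProd_isManin (η : ℂ) (ξ : Fin N → ℂ) (u : ℂ) : ∀ s : List (Fin N), s.Nodup →
    IsManin (laxProd m η ξ s (u + η)) (laxProd m η ξ s u)
      ((s.map fun n => (u + η - (ξ n - η / 2) + (m n : ℂ) / 2 * η) *
        (u - (ξ n - η / 2) - (m n : ℂ) / 2 * η)).prod • (1 : Op m))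
  | [], _ => by
    intro i j
    fin_cases i <;> fin_cases j <;> simp [laxProd]
  | n :: s, hs => by
    obtain ⟨hn, hs⟩ := List.nodup_cons.1 hs
    rw [laxProd_cons, laxProd_cons, List.map_cons, List.prod_cons]
    have h1 := (isSpinTriple_embed m n).isManin η (u - ξ n + η / 2)
    have h2 : IsManin (lax m η n (u + η - ξ n)) (lax m η n (u - ξ n))
        (((u + η - (ξ n - η / 2) + (m n : ℂ) / 2 * η) *
          (u - (ξ n - η / 2) - (m n : ℂ) / 2 * η)) • (1 : Op m)) := by
      rw [lax_eq_laxMatrix, lax_eq_laxMatrix]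
      convert h1 using 2 <;> ring
    have := h2.mul (laxProd_isManin η ξ u s hs) (lax_laxProd_entriesCommute m η ξ hn _ _)
    rwa [smul_mul_smul_comm, one_mul] at this

/-- The constant terms are products of `2s + 1` first-row entries, which leave no basis vector in
the range; the twisted derivation by `S⁺` does the rest. -/
theorem rowProd_lax_eq_zero (η : ℂ) (n : Fin N) (v : ℕ → ℂ)
    (hv : ∀ j, v j + η / 2 = ((m n : ℂ) - j - (m n : ℂ) / 2) * η) (I : Fin (m n + 1) → Fin 2) :
    rowProd (fun j => lax m η n (v j)) (m n + 1) I = 0 := by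
  have hS := isSpinTriple_embed m n
  simp only [lax_eq_laxMatrix, hv]
  refine rowProd_eq_zero_of_coeff_zero (fun j => hS.twistedDeriv_rowPoly_zero _ _)
    (fun j => hS.twistedDeriv_rowPoly_one _ _) (fun I => ?_) I
  rw [rowProd, ← constantCoeff_apply, map_list_prod, List.map_ofFn]
  let φ := embedHom (ι := fun k => Fin (m k + 1)) n
  have h0 : (List.ofFn fun j : Fin (m n + 1) =>
      laxMatrix η ((((m n + 1 : ℕ) : ℂ) - 1 - (j : ℕ) - ((m n : ℕ) : ℂ) / 2) * η)
      (spinZ (m n)) (spinPlus (m n)) (spinMinus (m n)) 0 (I j)).prod = 0 := by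
    ext i i'
    exact prod_laxMatrix_apply_eq_zero η (m n) (m n + 1) I i i' i.2
  have h1 := congrArg φ h0
  rw [map_list_prod, List.map_ofFn, map_zero] at h1
  rw [← h1]
  congr 2
  funext j
  have e : ((m n + 1 : ℕ) : ℂ) - 1 = m n := by push_cast; ring
  simp only [Function.comp_apply, e, laxMatrix_map]
  simp [rowPoly, φ, embedHom_apply]

/-- By `rowProd_mul` each term contains a column product of the first site and a coefficient from
the remaining sites; one of the two belongs to the part containing `n`. -/
theorem rowProd_laxProd_eq_zero (η : ℂ) (ξ : Fin N → ℂ) (n : Fin N) (U : ℕ → ℂ)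
    (hU : ∀ j, U j = U (j + 1) + η)
    (hv : ∀ j, U j - ξ n + η / 2 = ((m n : ℂ) - j - (m n : ℂ) / 2) * η) :
    ∀ s : List (Fin N), s.Nodup → n ∈ s → ∀ I : Fin (m n + 1) → Fin 2,
      rowProd (fun j => laxProd m η ξ s (U j)) (m n + 1) I = 0
  | [], _, hmem, _ => by simp at hmem
  | n' :: s, hs, hmem, I => by
    obtain ⟨hn, hs'⟩ := List.nodup_cons.1 hs
    simp only [laxProd_cons]
    have hM : ∀ j, IsManin (lax m η n' (U j - ξ n')) (lax m η n' (U (j + 1) - ξ n'))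
        _ := fun j => by
      have := laxProd_isManin m η ξ (U (j + 1)) [n'] (List.nodup_singleton _)
      rw [← hU] at this
      simpa only [laxProd, List.map_cons, List.map_nil, List.prod_cons, List.prod_nil, mul_one]
        using this
    rw [rowProd_mul (A := fun j => lax m η n' (U j - ξ n')) hM
      fun i j => lax_laxProd_entriesCommute m η ξ hn _ _]
    refine Finset.sum_eq_zero fun k _ => ?_
    rcases List.mem_cons.1 hmem with rfl | hmem
    · rw [rowProd_lax_eq_zero m η n (fun j => U j - ξ n) hv, zero_mul]
    · rw [rowProd_laxProd_eq_zero η ξ n U hU hv s hs' hmem, coeff_zero, C_0, mul_zero]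

/-- The sites in the order in which they occur in the monodromy matrix. -/
def siteList (N : ℕ) : List (Fin N) := (List.finRange N).map Fin.rev

theorem siteList_nodup (N : ℕ) : (siteList N).Nodup :=
  (List.nodup_finRange N).map Fin.rev_injective

theorem mem_siteList (n : Fin N) : n ∈ siteList N :=
  List.mem_map.2 ⟨n.rev, List.mem_finRange _, Fin.rev_rev n⟩

theorem monodromy_eq (η : ℂ) (ξ : Fin N → ℂ) (K : Matrix (Fin 2) (Fin 2) ℂ) (u : ℂ) :
    monodromy m η ξ K u = auxOp m K * laxProd m η ξ (siteList N) u := by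
  rw [monodromy, laxProd, siteList, List.map_map, List.ofFn_eq_map]
  rfl

theorem monodromy_isRTT (η : ℂ) (ξ : Fin N → ℂ) (K : Matrix (Fin 2) (Fin 2) ℂ) (u v : ℂ) :
    IsRTT (u - v) η (monodromy m η ξ K u) (monodromy m η ξ K v) := by
  rw [monodromy_eq, monodromy_eq]
  exact (auxOp_isRTT m _ _ K).mul (laxProd_isRTT m η ξ u v _ (siteList_nodup N))
    (auxOp_entriesCommute m K _) (auxOp_entriesCommute m K _)

theorem transfer_commute (η : ℂ) (ξ : Fin N → ℂ) (K : Matrix (Fin 2) (Fin 2) ℂ) (u v : ℂ) :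
    Commute (transfer m η ξ K u) (transfer m η ξ K v) := by
  by_cases h : u = v
  · rw [h]
  · refine (monodromy_isRTT m η ξ K u v).trace_commute ?_ (Or.inl (sub_ne_zero.2 h))
    rw [neg_sub]
    exact monodromy_isRTT m η ξ K v u

theorem monodromy_isManin (η : ℂ) (ξ : Fin N → ℂ) (K : Matrix (Fin 2) (Fin 2) ℂ) (u : ℂ) :
    IsManin (monodromy m η ξ K (u + η)) (monodromy m η ξ K u)
      ((K.det * (aFun m η ξ (u + η) * dFun m η ξ u)) • (1 : Op m)) := by
  rw [monodromy_eq, monodromy_eq]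
  have h := (auxOp_isManin m K).mul (laxProd_isManin m η ξ u _ (siteList_nodup N))
    (auxOp_entriesCommute m K _)
  have e : ∀ f : Fin N → ℂ, ((siteList N).map f).prod = ∏ n, f n := by
    intro f
    rw [← List.prod_toFinset f (siteList_nodup N)]
    refine Finset.prod_congr (Finset.ext fun n => ?_) fun _ _ => rfl
    simp [mem_siteList]
  rwa [smul_mul_smul_comm, one_mul, e, Finset.prod_mul_distrib] at h

theorem monodromySeq_isManin (η : ℂ) (ξ : Fin N → ℂ) (K : Matrix (Fin 2) (Fin 2) ℂ) (l : ℕ)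
    (u : ℂ) (j : ℕ) :
    IsManin (monodromySeq m η ξ K l u j) (monodromySeq m η ξ K l u (j + 1))
      ((K.det * (aFun m η ξ (u + ((l : ℂ) - 1 - j) * η) *
        dFun m η ξ (u + ((l : ℂ) - 1 - (j + 1 : ℕ)) * η))) • (1 : Op m)) := by
  have h := monodromy_isManin m η ξ K (u + ((l : ℂ) - 1 - (j + 1 : ℕ)) * η)
  rwa [show u + ((l : ℂ) - 1 - (j + 1 : ℕ)) * η + η = u + ((l : ℂ) - 1 - j) * η by
    push_cast; ring] at h

theorem symTrace_monodromySeq_eq_zero (η : ℂ) (ξ : Fin N → ℂ) (K : Matrix (Fin 2) (Fin 2) ℂ)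
    (n : Fin N) :
    symTrace (monodromySeq m η ξ K (m n + 1) (shiftedXi m η ξ n (m n))) (m n + 1) = 0 := by
  set U : ℕ → ℂ := fun j => shiftedXi m η ξ n (m n) + (((m n + 1 : ℕ) : ℂ) - 1 - j) * η with hU
  have hA : monodromySeq m η ξ K (m n + 1) (shiftedXi m η ξ n (m n)) =
      fun j => auxOp m K * laxProd m η ξ (siteList N) (U j) := by
    funext j
    rw [← monodromy_eq]
    rfl
  refine Finset.sum_eq_zero fun k _ => ?_
  rw [hA, rowProd_mul (A := fun _ => auxOp m K) (fun _ => auxOp_isManin m K)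
    fun i j => auxOp_entriesCommute m K _]
  simp only [rowProd_laxProd_eq_zero m η ξ n U (fun j => by simp only [hU]; push_cast; ring)
    (fun j => by simp only [hU, shiftedXi]; push_cast; ring) _ (siteList_nodup N) (mem_siteList n),
    coeff_zero, C_0, mul_zero, Finset.sum_const_zero]

end ChainRelations


/-! ### Tridiagonal determinants with operator entries -/

section Determinant

/-- The tridiagonal matrix with diagonal `t`, upper diagonal `b` and lower diagonal `c`, all
indexed by rows. -/
def tridiagonal {S : Type*} [Zero S] (t b c : ℕ → S) (l : ℕ) : Matrix (Fin l) (Fin l) S :=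
  Matrix.of fun i j =>
    if j = i then t i else if (j : ℕ) = i + 1 then b i else if (i : ℕ) = j + 1 then c i else 0

theorem tridiagonal_map {S R : Type*} [Zero S] [Zero R] (f : S → R) (hf : f 0 = 0) (t b c : ℕ → S)
    (l : ℕ) : (tridiagonal t b c l).map f =
      tridiagonal (fun j => f (t j)) (fun j => f (b j)) (fun j => f (c j)) l := by
  ext i j
  simp only [tridiagonal, Matrix.map_apply, Matrix.of_apply]
  split_ifs <;> simp [hf]

/-- Expansion along the last row leaves two terms; the minor of the off-diagonal one is expanded
along its last column, whose only nonzero entry can be `b l`. -/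
theorem det_tridiagonal_succ_succ {S : Type*} [CommRing S] (t b c : ℕ → S) (l : ℕ) :
    (tridiagonal t b c (l + 2)).det =
      (tridiagonal t b c (l + 1)).det * t (l + 1) -
        (tridiagonal t b c l).det * (b l * c (l + 1)) := by
  have hsub : ∀ l, (tridiagonal t b c (l + 1)).submatrix Fin.castSucc Fin.castSucc =
      tridiagonal t b c l := by
    intro l
    ext i j
    simp [tridiagonal]
  have hminor : ((tridiagonal t b c (l + 2)).submatrix Fin.castSucc
      (Fin.last l).castSucc.succAbove).det = (tridiagonal t b c l).det * b l := by
    rw [Matrix.det_succ_column _ (Fin.last l), Fin.sum_univ_castSucc, Finset.sum_eq_zero, zero_add]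
    · have h1 : ((tridiagonal t b c (l + 2)).submatrix Fin.castSucc
          (Fin.last l).castSucc.succAbove).submatrix (Fin.last l).succAbove
            (Fin.last l).succAbove = tridiagonal t b c l := by
        ext i j
        have : (Fin.last l).castSucc.succAbove ((Fin.last l).succAbove j) =
            j.castSucc.castSucc := by
          rw [Fin.succAbove_last, Fin.succAbove_of_castSucc_lt]
          simp [Fin.lt_def]
        rw [Matrix.submatrix_apply, Matrix.submatrix_apply, this]
        simp [tridiagonal]
      have h2 : (Fin.last l).castSucc.succAbove (Fin.last l) = Fin.last (l + 1) := by
        rw [Fin.succAbove_of_le_castSucc _ _ le_rfl, Fin.succ_last]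
      rw [h1, Matrix.submatrix_apply, h2]
      have h3 : tridiagonal t b c (l + 2) (Fin.last l).castSucc (Fin.last (l + 1)) = b l := by
        simp [tridiagonal, Fin.ext_iff]
      rw [h3, ← two_mul, pow_mul]
      simp [mul_comm]
    · intro i _
      have h2 : (Fin.last l).castSucc.succAbove (Fin.last l) = Fin.last (l + 1) := by
        rw [Fin.succAbove_of_le_castSucc _ _ le_rfl, Fin.succ_last]
      have h3 : tridiagonal t b c (l + 2) i.castSucc.castSucc (Fin.last (l + 1)) = 0 := by
        have := i.2
        simp only [tridiagonal, Matrix.of_apply, Fin.ext_iff, Fin.val_last, Fin.val_castSucc]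
        rw [if_neg (by omega), if_neg (by omega), if_neg (by omega)]
      rw [Matrix.submatrix_apply, h2, h3, mul_zero, zero_mul]
  rw [Matrix.det_succ_row _ (Fin.last (l + 1)), Fin.sum_univ_castSucc, Fin.sum_univ_castSucc,
    Finset.sum_eq_zero, zero_add]
  · rw [Fin.succAbove_last, hsub, hminor]
    have h1 : tridiagonal t b c (l + 2) (Fin.last (l + 1)) (Fin.last (l + 1)) = t (l + 1) := by
      simp [tridiagonal]
    have h2 : tridiagonal t b c (l + 2) (Fin.last (l + 1)) (Fin.last l).castSucc = c (l + 1) := by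
      simp only [tridiagonal, Matrix.of_apply, Fin.ext_iff, Fin.val_last, Fin.val_castSucc]
      rw [if_neg (by omega), if_neg (by omega), if_pos trivial]
    rw [h1, h2, ← two_mul, pow_mul]
    have h3 : ((Fin.last (l + 1) : Fin (l + 2)) : ℕ) + ((Fin.last l).castSucc : Fin (l + 2)) =
        2 * l + 1 := by
      simp
      ring
    rw [h3, pow_succ, pow_mul]
    simp
    ring
  · intro j _
    have h3 : tridiagonal t b c (l + 2) (Fin.last (l + 1)) j.castSucc.castSucc = 0 := by
      have := j.2
      simp only [tridiagonal, Matrix.of_apply, Fin.ext_iff, Fin.val_last, Fin.val_castSucc]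
      rw [if_neg (by omega), if_neg (by omega), if_neg (by omega)]
    rw [h3, mul_zero, zero_mul]

theorem opDet_map {S : Type*} {R : Type} [CommRing S] [Ring R] (f : S →+* R) {l : ℕ}
    (A : Matrix (Fin l) (Fin l) S) : opDet (A.map f) = f A.det := by
  rw [opDet, Matrix.det_apply, map_sum]
  refine Finset.sum_congr rfl fun σ _ => ?_
  rw [Units.smul_def, map_zsmul, ← List.prod_ofFn, map_list_prod, List.map_ofFn]
  rfl

/-- The determinant formula for the symmetric traces. -/
theorem symTrace_eq_det {S : Type*} {R : Type*} [CommRing S] [Ring R] (f : S →+* R)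
    {A : ℕ → Matrix (Fin 2) (Fin 2) R} {q : ℕ → R}
    (h : ∀ j, IsManin (A j) (A (j + 1)) (q j)) (t b c : ℕ → S)
    (ht : ∀ j, f (t j) = (A j).trace) (hq : ∀ j, f (b j * c (j + 1)) = q j) :
    ∀ l, symTrace A l = f (tridiagonal t b c l).det
  | 0 => by simp [symTrace_zero]
  | 1 => by
    rw [symTrace_one h, ← ht]
    simp [tridiagonal]
  | l + 2 => by
    rw [symTrace_succ_succ h, det_tridiagonal_succ_succ, map_sub, map_mul, map_mul f _ (b l * _), ht,
      hq, symTrace_eq_det f h t b c ht hq l, symTrace_eq_det f h t b c ht hq (l + 1)]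

-- The traces generate a commutative subalgebra, in which the ordinary determinant and its recursion
-- are available; the inclusion then carries the result to `R`.
open scoped IsMulCommutative in
theorem opDet_tridiagonal {R : Type} [Ring R] [Algebra ℂ R] {A : ℕ → Matrix (Fin 2) (Fin 2) R}
    (hcomm : ∀ i j, Commute (A i).trace (A j).trace) (b c : ℕ → ℂ)
    (h : ∀ j, IsManin (A j) (A (j + 1)) ((b j * c (j + 1)) • (1 : R))) (l : ℕ) :
    opDet (tridiagonal (fun j => (A j).trace) (fun j => b j • (1 : R)) (fun j => c j • (1 : R)) l) =
      symTrace A l := by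
  let s : Set R := Set.range fun j => (A j).trace
  have hs : ∀ a ∈ s, ∀ b ∈ s, a * b = b * a := by
    rintro _ ⟨i, rfl⟩ _ ⟨j, rfl⟩
    exact hcomm i j
  have := Algebra.isMulCommutative_adjoin ℂ hs
  let f : Algebra.adjoin ℂ s →+* R := (Algebra.adjoin ℂ s).val.toRingHom
  let t : ℕ → Algebra.adjoin ℂ s := fun j => ⟨(A j).trace, Algebra.subset_adjoin ⟨j, rfl⟩⟩
  let b' : ℕ → Algebra.adjoin ℂ s := fun j => algebraMap ℂ _ (b j)
  let c' : ℕ → Algebra.adjoin ℂ s := fun j => algebraMap ℂ _ (c j)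
  have hb : ∀ z : ℂ, f (algebraMap ℂ _ z) = z • (1 : R) := fun z => Algebra.algebraMap_eq_smul_one z
  rw [symTrace_eq_det f h t b' c' (fun j => rfl) fun j => ?_, ← opDet_map,
    tridiagonal_map f (map_zero f)]
  · simp only [b', c', hb]
    rfl
  · rw [map_mul, hb, hb, smul_mul_smul_comm, one_mul]

end Determinant

/-! ### Polynomial dependence on the spectral parameter -/

section Polynomiality

variable {N : ℕ} (m : Fin N → ℕ)

theorem exists_laxProd_expansion (η : ℂ) (ξ : Fin N → ℂ) : ∀ s : List (Fin N),
    ∃ c : ℕ → Matrix (Fin 2) (Fin 2) (Op m), c s.length = 1 ∧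
      ∀ u, laxProd m η ξ s u = ∑ k ∈ Finset.range (s.length + 1), u ^ k • c k
  | [] => ⟨fun _ => 1, rfl, fun u => by simp [laxProd]⟩
  | n :: s => by
    obtain ⟨c, hc, hu⟩ := exists_laxProd_expansion η ξ s
    have hl : ∀ u, lax m η n (u - ξ n) = u • 1 + lax m η n (-ξ n) := by
      intro u
      ext1 i j
      rw [lax_eq_laxMatrix, lax_eq_laxMatrix, Matrix.add_apply, Matrix.smul_apply, laxMatrix_apply,
        laxMatrix_apply]
      have : (1 : Matrix (Fin 2) (Fin 2) (Op m)) i j =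
          (1 : Matrix (Fin 2) (Fin 2) ℂ) i j • (1 : Op m) := by
        rw [Matrix.one_apply, Matrix.one_apply]
        split_ifs <;> simp
      rw [this]
      module
    set B := lax m η n (-ξ n)
    -- Coefficients of `(u + B) ∑ uᵏ cₖ`. The guards are needed because `k - 1` truncates at `0` and
    -- `c` is arbitrary beyond `s.length`.
    refine ⟨fun k => (if k = 0 then 0 else c (k - 1)) + (if k ≤ s.length then B * c k else 0),
      by simp [hc], fun u => ?_⟩
    rw [laxProd_cons, hl, hu, add_mul, smul_mul_assoc, one_mul, List.length_cons]
    simp only [smul_add, Finset.sum_add_distrib]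
    congr 1
    · rw [Finset.sum_range_succ' _ (s.length + 1), Finset.smul_sum]
      simp [smul_smul, pow_succ']
    · rw [Finset.sum_range_succ _ (s.length + 1), Finset.mul_sum, if_neg (by omega), smul_zero, add_zero]
      refine Finset.sum_congr rfl fun k hk => ?_
      rw [if_pos (Nat.lt_succ_iff.1 (Finset.mem_range.1 hk)), mul_smul_comm]

theorem exists_transfer_expansion (η : ℂ) (ξ : Fin N → ℂ) (K : Matrix (Fin 2) (Fin 2) ℂ) :
    ∃ c : ℕ → Op m, c N = K.trace • 1 ∧
      ∀ u, transfer m η ξ K u = ∑ k ∈ Finset.range (N + 1), u ^ k • c k := by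
  obtain ⟨c, hc, hu⟩ := exists_laxProd_expansion m η ξ (siteList N)
  have hN : (siteList N).length = N := by simp [siteList]
  rw [hN] at hc hu
  refine ⟨fun k => (auxOp m K * c k).trace, ?_, fun u => ?_⟩
  · simp [hc, auxOp, Matrix.trace_fin_two, add_smul]
  · rw [transfer, monodromy_eq, hu, Finset.mul_sum, Matrix.trace_sum]
    refine Finset.sum_congr rfl fun k _ => ?_
    rw [mul_smul_comm, Matrix.trace_smul]

end Polynomiality

end HigherSpin


/-! ### The main theorem -/

open HigherSpin in
theorem proposition4p2 (N : ℕ) (m : Fin N → ℕ) (hm : ∀ n, 0 < m n) (η : ℂ) (ξ : Fin N → ℂ)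
    (K : Matrix (Fin 2) (Fin 2) ℂ) :
    (∃ P : Polynomial (HigherSpin.Op m),
        P.natDegree ≤ N ∧
        P.coeff N = K.trace • (1 : HigherSpin.Op m) ∧
        (K.trace ≠ 0 → P.natDegree = N) ∧
        ∀ u : ℂ, HigherSpin.transfer m η ξ K u = P.eval (u • (1 : HigherSpin.Op m))) ∧
    Filter.Tendsto (fun u : ℂ => (u ^ N)⁻¹ • HigherSpin.transfer m η ξ K u)
      (Bornology.cobounded ℂ) (𝓝 (K.trace • (1 : HigherSpin.Op m))) ∧
    (∀ u v : ℂ, Commute (HigherSpin.transfer m η ξ K u) (HigherSpin.transfer m η ξ K v)) ∧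
    ∀ k₁ k₂ : ℂ, K.charpoly.roots = {k₁, k₂} → ∀ n : Fin N,
      HigherSpin.fusedTransfer m η ξ K (m n + 1) (HigherSpin.shiftedXi m η ξ n (m n)) =
        HigherSpin.opDet
          (HigherSpin.tridiag m η ξ K k₁ k₂ (m n + 1) (HigherSpin.shiftedXi m η ξ n (m n))) ∧
      HigherSpin.opDet
        (HigherSpin.tridiag m η ξ K k₁ k₂ (m n + 1) (HigherSpin.shiftedXi m η ξ n (m n))) = 0 := by
  obtain ⟨c, hc, hu⟩ := exists_transfer_expansion m η ξ K
  have hcoeff : (∑ k ∈ Finset.range (N + 1),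
      Polynomial.C (c k) * Polynomial.X ^ k : Polynomial (Op m)).coeff N = c N := by
    simp [Polynomial.finsetSum_coeff, Polynomial.coeff_X_pow]
  refine ⟨⟨∑ k ∈ Finset.range (N + 1), Polynomial.C (c k) * Polynomial.X ^ k, ?_, ?_, ?_, ?_⟩,
    ?_, transfer_commute m η ξ K, ?_⟩
  · exact Polynomial.natDegree_sum_le_of_forall_le _ _ fun k hk =>
      (Polynomial.natDegree_C_mul_X_pow_le _ _).trans (Nat.lt_succ_iff.1 (Finset.mem_range.1 hk))
  · rw [hcoeff, hc]
  · intro hK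
    refine le_antisymm (Polynomial.natDegree_sum_le_of_forall_le _ _ fun k hk =>
      (Polynomial.natDegree_C_mul_X_pow_le _ _).trans (Nat.lt_succ_iff.1 (Finset.mem_range.1 hk)))
      (Polynomial.le_natDegree_of_ne_zero ?_)
    rw [hcoeff, hc]
    exact smul_ne_zero hK one_ne_zero
  · intro u
    rw [hu, Polynomial.eval_finsetSum]
    refine Finset.sum_congr rfl fun k _ => ?_
    simp [_root_.smul_pow]
  · have hsum : K.trace • (1 : Op m) =
        ∑ k ∈ Finset.range (N + 1), (if k = N then (1 : ℂ) else 0) • c k := by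
      simp [hc]
    simp only [hu, Finset.smul_sum, smul_smul]
    rw [hsum]
    refine tendsto_finsetSum _ fun k hk => Filter.Tendsto.smul_const ?_ (c k)
    have hk : k ≤ N := Nat.lt_succ_iff.1 (Finset.mem_range.1 hk)
    -- Only the leading term survives; for `k = N` the limit is `0 ^ 0 = 1`.
    have hlim : Filter.Tendsto (fun u : ℂ => (u⁻¹) ^ (N - k)) (Bornology.cobounded ℂ)
        (𝓝 (if k = N then (1 : ℂ) else 0)) := by
      have := (Filter.tendsto_inv₀_cobounded (α := ℂ)).pow (N - k)
      rwa [show (0 : ℂ) ^ (N - k) = if k = N then (1 : ℂ) else 0 by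
        rw [zero_pow_eq]
        exact if_congr (by omega) rfl rfl] at this
    refine hlim.congr' ?_
    filter_upwards [Bornology.eventually_ne_cobounded (0 : ℂ)] with u hu0
    rw [inv_pow, inv_eq_iff_eq_inv, mul_inv, inv_inv, ← div_eq_mul_inv, pow_sub₀ u hu0 hk,
      div_eq_mul_inv]
  · intro k₁ k₂ hk n
    -- The eigenvalues enter only through their product, so their order is irrelevant and `K` need
    -- not be diagonalisable.
    have hdet : K.det = k₁ * k₂ := by
      rw [Matrix.det_eq_prod_roots_charpoly, hk]
      simp
    set u := shiftedXi m η ξ n (m n)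
    have hM := monodromySeq_isManin m η ξ K (m n + 1) u
    have htri : tridiag m η ξ K k₁ k₂ (m n + 1) u =
        tridiagonal (fun j => (monodromySeq m η ξ K (m n + 1) u j).trace)
          (fun j => (-(k₁ * aFun m η ξ (u + (((m n + 1 : ℕ) : ℂ) - 1 - j) * η))) • (1 : Op m))
          (fun j => (-(k₂ * dFun m η ξ (u + (((m n + 1 : ℕ) : ℂ) - 1 - j) * η))) • (1 : Op m))
          (m n + 1) := rfl
    have hdetl : opDet (tridiag m η ξ K k₁ k₂ (m n + 1) u) =
        symTrace (monodromySeq m η ξ K (m n + 1) u) (m n + 1) := by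
      rw [htri]
      refine opDet_tridiagonal (fun i j => transfer_commute m η ξ K _ _) _ _ (fun j => ?_) _
      -- The signs of the two off-diagonals cancel in their product, which is the quantum
      -- determinant.
      have hq := hM j
      rwa [hdet, mul_mul_mul_comm, ← neg_mul_neg (k₁ * _)] at hq
    rw [fusedTransfer_eq_symTrace m η ξ K (m n + 1) u hM, hdetl]
    exact ⟨rfl, symTrace_monodromySeq_eq_zero m η ξ K n⟩
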